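/- Fix $\beta\in(0,1)$ and $x>0$. Put $$C_1=\log(1-\beta)-\log\log 4-\gamma-\sum_{k=2}^{\infty}\sum_{p}\frac{\log p}{p^k}-1,$$ where $\gamma$ is Euler's constant and $p$ runs over the prime numbers, and for real $T$ let $\mathscr{M}(T,x)$ be the Lebesgue measure of the set $$\left\{t\in[T^{\beta},T]\;:\;-\operatorname{Re}\frac{\zeta'}{\zeta}(1+it)\ \geq\ \log\log T+\log\log\log T+C_1-x\right\},$$ where $\zeta$ is the Riemann zeta function. Then $$\mathscr{M}(T,x)\ \geq\ T^{\,1-(1-\beta)e^{-x}+o(1)}\qquad\text{as } T\to\infty,$$ where, for fixed $\beta$ and $x$, $o(1)$ denotes a function of $T$ tending to $0$. -/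

import Mathlib

/-- The constant
`C₁ = log (1 - β) - log (log 4) - γ - ∑_{k ≥ 2} ∑_p (log p) / p ^ k - 1`,
where `γ` is Euler's constant and `p` runs over the primes; the outer sum is indexed by `k - 2`. -/
noncomputable def C₁ (β : ℝ) : ℝ :=
  Real.log (1 - β) - Real.log (Real.log 4) - Real.eulerMascheroniConstant
    - (∑' k : ℕ, ∑' p : Nat.Primes, Real.log (p : ℕ) / ((p : ℕ) : ℝ) ^ (k + 2)) - 1

/-- The set of `t ∈ [T ^ β, T]` with
`-Re (ζ'/ζ)(1 + i t) ≥ log log T + log log log T + C₁ - x`. -/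
def largeValueSet (β T x : ℝ) : Set ℝ :=
  {t : ℝ | t ∈ Set.Icc (T ^ β) T ∧
    Real.log (Real.log T) + Real.log (Real.log (Real.log T)) + C₁ β - x ≤
      -(deriv riemannZeta (1 + Complex.I * (t : ℂ)) / riemannZeta (1 + Complex.I * (t : ℂ))).re}

/-- The Lebesgue measure `M(T, x)` of the set of large values. -/
noncomputable def largeValueMeasure (β T x : ℝ) : ENNReal :=
  MeasureTheory.volume (largeValueSet β T x)

/-! The proof is the resonance method, run directly on the line `Re s = 1` with the Fejér kernel.

For `t ∈ [0, T]` weigh `-Re ζ'/ζ (1 + i t)` by `(1 - t / T) |R(t)|²`, where the resonator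
`R(t) = ∏_{p ≤ N} (1 - r(p) p ^ (-i t))⁻¹` has `r(p) = 1 - p / N` and `N` is of order
`log T * log (log T)`. All functions involved are trigonometric series with nonnegative
coefficients (`IsPosTrig`), and such a series has nonnegative integral against `1 - t / T`. For a
prime power `d = p ^ k ≤ N` the series `(p ^ (-i k t) - r(p) ^ k) |R(t)|²` is of this kind
(`isPosTrig_primePow_sub_mul_weight`), and so is the tail of the Dirichlet series of `-ζ'/ζ` to the
right of the line. Hence the weighted mean of `-Re ζ'/ζ` is at least
`∑_{d ≤ N} Λ(d) / d * (1 - d / N)`. Letting `σ → 1`, the only trace of the pole is a term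
`π / 2 * |R(0)|²`, which is negligible, since `1 / (i t)` has real part `0` (`resonance_line`).
In particular neither zero-density estimates nor an approximation of `ζ'/ζ` is needed.

On the other hand `|ζ'/ζ (1 + i t)|` is `O(log ^ 10 t)` (`exists_abs_regularPart_le`), so the
`t ≤ T ^ β` and the `t` with large values can produce this mean only if the large values have measure
at least `T ^ (1 - o(1))` times the ratio of the mean of `|R|²` to its maximum `|R(0)|²`
(`resonance_measure`). This ratio is `∏_{p ≤ N} (2 N / p - 1)⁻¹`, and `N` is chosen so that it is
at least `T ^ (-(1 - β) e ^ (-x))`.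

The prime number theorem is not used. The main term counts all prime powers, whereas the constant
`C₁` subtracts those with exponent at least `2`; this leaves room for two losses. Averaging
Mertens' inequality `∑_{d ≤ m} Λ(d) / d ≥ log m - 1` gives the main term `log N - 2` instead of
`log N - γ - 1` (`le_sum_vonMangoldt_div_mul`), and Chebyshev's bound `ψ(n) ≤ 1.11 n + O(1)`
costs a factor `1.112` in `N` (`eventually_logRatio_le`). The comparison `slack_pos` needs only
`γ > 1 / 2` and the primes `2, 3, 5`. -/

namespace LargeValues

open Complex MeasureTheory Filter Topology ComplexConjugate

/-! ### Trigonometric series with nonnegative coefficients -/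

/-- `f` is an absolutely convergent trigonometric series `∑ aᵢ exp (i lᵢ t)` with real frequencies
`lᵢ` and coefficients `aᵢ ≥ 0`. -/
def IsPosTrig (f : ℝ → ℂ) : Prop :=
  ∃ (ι : Type) (_ : Countable ι) (a l : ι → ℝ), (∀ i, 0 ≤ a i) ∧ Summable a ∧
    ∀ t : ℝ, HasSum (fun i ↦ (a i : ℂ) * exp (I * (l i * t))) (f t)

lemma norm_mul_exp_I (a l t : ℝ) : ‖(a : ℂ) * exp (I * (l * t))‖ = |a| := by
  have : I * (l * t : ℂ) = ((l * t : ℝ) : ℂ) * I := by push_cast; ring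
  rw [norm_mul, this, norm_exp_ofReal_mul_I, mul_one, norm_real, Real.norm_eq_abs]

namespace IsPosTrig

variable {f g : ℝ → ℂ}

lemma of_summable {ι : Type} [Countable ι] {a l : ι → ℝ} (ha : ∀ i, 0 ≤ a i) (hs : Summable a) :
    IsPosTrig (fun t ↦ ∑' i, (a i : ℂ) * exp (I * (l i * t))) := by
  refine ⟨ι, inferInstance, a, l, ha, hs, fun t ↦ Summable.hasSum ?_⟩
  refine Summable.of_norm ?_
  simpa only [norm_mul_exp_I] using hs.abs

lemma const_mul_exp {c : ℝ} (hc : 0 ≤ c) (l : ℝ) :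
    IsPosTrig (fun t ↦ (c : ℂ) * exp (I * (l * t))) :=
  ⟨Unit, inferInstance, fun _ ↦ c, fun _ ↦ l, fun _ ↦ hc, (hasSum_fintype _).summable,
    fun t ↦ by
      simpa only [Finset.univ_unique, Finset.sum_singleton] using
        hasSum_fintype (fun _ : Unit ↦ (c : ℂ) * exp (I * (l * t)))⟩

lemma const {c : ℝ} (hc : 0 ≤ c) : IsPosTrig (fun _ ↦ (c : ℂ)) := by
  simpa using const_mul_exp hc 0

protected lemma add (hf : IsPosTrig f) (hg : IsPosTrig g) : IsPosTrig (fun t ↦ f t + g t) := by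
  obtain ⟨ι, _, a, l, ha, hs, hf⟩ := hf
  obtain ⟨κ, _, b, m, hb, hs', hg⟩ := hg
  refine ⟨ι ⊕ κ, inferInstance, Sum.elim a b, Sum.elim l m, ?_, ?_, fun t ↦ ?_⟩
  · rintro (i | i)
    · exact ha i
    · exact hb i
  · exact (HasSum.sum (f := Sum.elim a b) hs.hasSum hs'.hasSum).summable
  · exact HasSum.sum (f := fun i : ι ⊕ κ ↦
      ((Sum.elim a b i : ℝ) : ℂ) * exp (I * ((Sum.elim l m i : ℝ) * t))) (hf t) (hg t)

protected lemma mul (hf : IsPosTrig f) (hg : IsPosTrig g) : IsPosTrig (fun t ↦ f t * g t) := by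
  obtain ⟨ι, _, a, l, ha, hs, hf⟩ := hf
  obtain ⟨κ, _, b, m, hb, hs', hg⟩ := hg
  have hsum : Summable fun i : ι × κ ↦ a i.1 * b i.2 :=
    hs.mul_of_nonneg hs' (fun i ↦ ha i) (fun i ↦ hb i)
  refine ⟨ι × κ, inferInstance, fun i ↦ a i.1 * b i.2, fun i ↦ l i.1 + m i.2,
    fun i ↦ mul_nonneg (ha _) (hb _), hsum, fun t ↦ ?_⟩
  have heq : ∀ i : ι × κ, ((a i.1 * b i.2 : ℝ) : ℂ) * exp (I * ((l i.1 + m i.2 : ℝ) * t)) =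
      ((a i.1 : ℂ) * exp (I * (l i.1 * t))) * ((b i.2 : ℂ) * exp (I * (m i.2 * t))) := fun i ↦ by
    rw [mul_mul_mul_comm, ← exp_add]
    push_cast
    ring_nf
  have hp : Summable fun i : ι × κ ↦
      ((a i.1 : ℂ) * exp (I * (l i.1 * t))) * ((b i.2 : ℂ) * exp (I * (m i.2 * t))) := by
    refine Summable.of_norm (hsum.congr fun i ↦ ?_)
    rw [norm_mul, norm_mul_exp_I, norm_mul_exp_I, abs_of_nonneg (ha _), abs_of_nonneg (hb _)]
  have h := HasSum.mul (hf t) (hg t) hp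
  exact h.congr_fun heq

lemma star (hf : IsPosTrig f) : IsPosTrig (fun t ↦ conj (f t)) := by
  obtain ⟨ι, _, a, l, ha, hs, hf⟩ := hf
  refine ⟨ι, inferInstance, a, fun i ↦ - l i, ha, hs, fun t ↦ ?_⟩
  convert hasSum_conj'.2 (hf t) using 2
  rw [map_mul, ← exp_conj]
  simp

lemma sum {ι : Type*} (s : Finset ι) {F : ι → ℝ → ℂ} (h : ∀ i ∈ s, IsPosTrig (F i)) :
    IsPosTrig (fun t ↦ ∑ i ∈ s, F i t) := by
  classical
  induction s using Finset.induction_on with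
  | empty => simpa using const le_rfl
  | insert i s hi ih =>
    simp only [Finset.sum_insert hi]
    exact (h i (by simp)).add (ih fun j hj ↦ h j (by simp [hj]))

lemma prod {ι : Type*} (s : Finset ι) {F : ι → ℝ → ℂ} (h : ∀ i ∈ s, IsPosTrig (F i)) :
    IsPosTrig (fun t ↦ ∏ i ∈ s, F i t) := by
  classical
  induction s using Finset.induction_on with
  | empty => simpa using const zero_le_one
  | insert i s hi ih =>
    simp only [Finset.prod_insert hi]
    exact (h i (by simp)).mul (ih fun j hj ↦ h j (by simp [hj]))

lemma pow (hf : IsPosTrig f) (n : ℕ) : IsPosTrig (fun t ↦ f t ^ n) := by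
  simpa using prod (Finset.range n) (F := fun _ ↦ f) fun _ _ ↦ hf

lemma continuous (hf : IsPosTrig f) : Continuous f := by
  obtain ⟨ι, _, a, l, ha, hs, hf⟩ := hf
  have : f = fun t : ℝ ↦ ∑' i, (a i : ℂ) * exp (I * (l i * t)) := funext fun t ↦ (hf t).tsum_eq.symm
  rw [this]
  refine continuous_tsum (fun i ↦ by fun_prop) hs (fun i t ↦ ?_)
  rw [norm_mul_exp_I, abs_of_nonneg (ha i)]

end IsPosTrig

/-- The Fejér kernel is nonnegative. -/
lemma integral_fejer_cos_nonneg {T : ℝ} (hT : 0 < T) (l : ℝ) :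
    0 ≤ ∫ t in (0 : ℝ)..T, (1 - t / T) * Real.cos (l * t) := by
  rcases eq_or_ne l 0 with rfl | hl
  · refine intervalIntegral.integral_nonneg hT.le fun t ht ↦ ?_
    have : t / T ≤ 1 := (div_le_one hT).2 ht.2
    simpa using this
  have key : ∀ t ∈ Set.uIcc 0 T, HasDerivAt
      (fun t ↦ (1 - t / T) * (Real.sin (l * t) / l) - Real.cos (l * t) / (T * l ^ 2))
      ((1 - t / T) * Real.cos (l * t)) t := by
    intro t _
    have h1 : HasDerivAt (fun t ↦ l * t) l t := by simpa using (hasDerivAt_id t).const_mul l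
    have h2 : HasDerivAt (fun t ↦ 1 - t / T) (-(1 / T)) t := by
      simpa using ((hasDerivAt_id t).div_const T).const_sub 1
    refine ((h2.mul (h1.sin.div_const l)).sub (h1.cos.div_const (T * l ^ 2))).congr_deriv ?_
    have hT' := hT.ne'
    field_simp
    ring
  rw [intervalIntegral.integral_eq_sub_of_hasDerivAt key
    (Continuous.intervalIntegrable (by fun_prop) _ _)]
  have : (1 - T / T) = 0 := by field_simp; ring
  simp only [this]
  have h3 := Real.cos_le_one (l * T)
  have h4 : 0 < T * l ^ 2 := by positivity
  have : 0 ≤ (1 - Real.cos (l * T)) / (T * l ^ 2) := div_nonneg (by linarith) h4.le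
  simp
  rw [sub_div] at this
  simpa using this

lemma IsPosTrig.integral_nonneg {f : ℝ → ℂ} (hf : IsPosTrig f) {T : ℝ} (hT : 0 < T) :
    0 ≤ ∫ t in (0 : ℝ)..T, (1 - t / T) * (f t).re := by
  obtain ⟨ι, _, a, l, ha, hs, hf⟩ := hf
  have h : HasSum (fun i ↦ ∫ t in (0 : ℝ)..T, (1 - t / T) * (a i * Real.cos (l i * t)))
      (∫ t in (0 : ℝ)..T, (1 - t / T) * (f t).re) := by
    refine intervalIntegral.hasSum_integral_of_dominated_convergence (fun i _ ↦ a i)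
      (fun i ↦ (Continuous.aestronglyMeasurable (by fun_prop))) (fun i ↦ ?_) ?_ ?_ ?_
    · refine ae_of_all _ fun t ht ↦ ?_
      rw [Set.uIoc_of_le hT.le] at ht
      have h0 : 0 ≤ t / T := div_nonneg ht.1.le hT.le
      have h1 : t / T ≤ 1 := (div_le_one hT).2 ht.2
      have h2 : |1 - t / T| ≤ 1 := by rw [abs_le]; constructor <;> linarith
      rw [norm_mul, norm_mul, Real.norm_eq_abs, Real.norm_eq_abs, Real.norm_eq_abs,
        abs_of_nonneg (ha i)]
      calc |1 - t / T| * (a i * |Real.cos (l i * t)|) ≤ 1 * (a i * 1) := by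
            gcongr
            · exact mul_nonneg (ha i) (abs_nonneg _)
            · exact ha i
            · exact Real.abs_cos_le_one _
        _ = a i := by ring
    · exact ae_of_all _ fun t _ ↦ hs
    · simp
    · refine ae_of_all _ fun t _ ↦ HasSum.mul_left _ ?_
      have hi := hasSum_re (hf t)
      refine hi.congr_fun fun i ↦ ?_
      have : I * (l i * t : ℂ) = ((l i * t : ℝ) : ℂ) * I := by push_cast; ring
      rw [this, re_ofReal_mul, exp_ofReal_mul_I_re]
  refine h.nonneg fun i ↦ ?_
  have : ∀ t, (1 - t / T) * (a i * Real.cos (l i * t)) =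
      a i * ((1 - t / T) * Real.cos (l i * t)) := fun t ↦ by ring
  simp only [this, intervalIntegral.integral_const_mul]
  exact mul_nonneg (ha i) (integral_fejer_cos_nonneg hT _)

/-! ### The resonator -/

/-- The geometric series `∑ rʲ exp (i j l t) = (1 - r exp (i l t))⁻¹`. -/
noncomputable def eulerFactor (r l t : ℝ) : ℂ := (1 - r * exp (I * (l * t)))⁻¹

lemma isPosTrig_exp (l : ℝ) : IsPosTrig (fun t ↦ exp (I * (l * t))) := by
  simpa using IsPosTrig.const_mul_exp zero_le_one l

lemma conj_exp_I_mul (l t : ℝ) : conj (exp (I * (l * t))) = (exp (I * (l * t)))⁻¹ := by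
  rw [← exp_conj, ← exp_neg]; simp

lemma one_sub_ne_zero {r : ℝ} (h0 : 0 ≤ r) (h1 : r < 1) (l t : ℝ) :
    1 - r * exp (I * (l * t)) ≠ 0 := by
  intro h
  have h2 : ‖(r : ℂ) * exp (I * (l * t))‖ = 1 := by rw [← sub_eq_zero.1 h, norm_one]
  rw [norm_mul_exp_I, abs_of_nonneg h0] at h2
  exact h1.ne h2

lemma one_sub_inv_ne_zero {r : ℝ} (h0 : 0 ≤ r) (h1 : r < 1) (l t : ℝ) :
    1 - r * (exp (I * (l * t)))⁻¹ ≠ 0 := by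
  have h := one_sub_ne_zero h0 h1 (-l) t
  rwa [ofReal_neg, neg_mul, mul_neg, exp_neg] at h

lemma isPosTrig_eulerFactor {r : ℝ} (h0 : 0 ≤ r) (h1 : r < 1) (l : ℝ) :
    IsPosTrig (eulerFactor r l) := by
  refine ⟨ℕ, inferInstance, fun j ↦ r ^ j, fun j ↦ j * l, fun j ↦ by positivity,
    summable_geometric_of_lt_one h0 h1, fun t ↦ ?_⟩
  have h : ‖(r : ℂ) * exp (I * (l * t))‖ < 1 := by
    rwa [norm_mul_exp_I, abs_of_nonneg h0]
  refine (hasSum_geometric_of_norm_lt_one h).congr_fun fun j ↦ ?_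
  rw [mul_pow, ← exp_nat_mul]
  push_cast
  ring_nf

lemma isPosTrig_eulerFactor_sub_one {r : ℝ} (h0 : 0 ≤ r) (h1 : r < 1) (l : ℝ) :
    IsPosTrig (fun t ↦ eulerFactor r l t - 1) := by
  have h := ((IsPosTrig.const h0).mul (isPosTrig_exp l)).mul (isPosTrig_eulerFactor h0 h1 l)
  convert h using 2 with t
  have := one_sub_ne_zero h0 h1 l t
  unfold eulerFactor
  generalize exp (I * (l * t)) = z at *
  field_simp
  ring

lemma isPosTrig_normSq_eulerFactor {r : ℝ} (h0 : 0 ≤ r) (h1 : r < 1) (l : ℝ) :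
    IsPosTrig (fun t ↦ eulerFactor r l t * conj (eulerFactor r l t)) :=
  (isPosTrig_eulerFactor h0 h1 l).mul (isPosTrig_eulerFactor h0 h1 l).star

lemma conj_eulerFactor (r l t : ℝ) :
    conj (eulerFactor r l t) = (1 - r * (exp (I * (l * t)))⁻¹)⁻¹ := by
  rw [eulerFactor, map_inv₀, map_sub, map_mul, conj_exp_I_mul, conj_ofReal, map_one]

/-- The factor `exp (i l t) - r` cancels the conjugate Euler factor up to `exp (i l t)`, so the
product has nonnegative coefficients although `-r` is negative. -/
lemma isPosTrig_exp_sub_mul_normSq {r : ℝ} (h0 : 0 ≤ r) (h1 : r < 1) (l : ℝ) :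
    IsPosTrig (fun t ↦ (exp (I * (l * t)) - r) *
      (eulerFactor r l t * conj (eulerFactor r l t))) := by
  convert (isPosTrig_exp l).mul (isPosTrig_eulerFactor h0 h1 l) using 2 with t
  have hne := one_sub_inv_ne_zero h0 h1 l t
  have hz := exp_ne_zero (I * (l * t))
  rw [conj_eulerFactor]
  generalize exp (I * (l * t)) = z at *
  have : z - r = z * (1 - r * z⁻¹) := by field_simp
  rw [this, mul_mul_mul_comm, mul_inv_cancel₀ hne, mul_one]

lemma isPosTrig_pow_sub_mul_normSq {r : ℝ} (h0 : 0 ≤ r) (h1 : r < 1) (l : ℝ) (k : ℕ) :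
    IsPosTrig (fun t ↦ (exp (I * (l * t)) ^ k - (r : ℂ) ^ k) *
      (eulerFactor r l t * conj (eulerFactor r l t))) := by
  have h := (IsPosTrig.sum (Finset.range k) (F := fun i t ↦ exp (I * (l * t)) ^ i *
    ((r ^ (k - 1 - i) : ℝ) : ℂ)) fun i _ ↦
      ((isPosTrig_exp l).pow i).mul (IsPosTrig.const (by positivity))).mul
        (isPosTrig_exp_sub_mul_normSq h0 h1 l)
  convert h using 2 with t
  push_cast
  rw [← (Commute.all _ _).geom_sum₂_mul]
  ring

/-- The Poisson kernel: the squared Euler factor has constant term `(1 - r²)⁻¹`. -/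
lemma isPosTrig_normSq_sub {r : ℝ} (h0 : 0 ≤ r) (h1 : r < 1) (l : ℝ) :
    IsPosTrig (fun t ↦ eulerFactor r l t * conj (eulerFactor r l t) -
      (((1 - r ^ 2)⁻¹ : ℝ) : ℂ)) := by
  have hr : 0 < 1 - r ^ 2 := by nlinarith
  have h := (IsPosTrig.const (inv_pos.2 hr).le).mul
    ((isPosTrig_eulerFactor_sub_one h0 h1 l).add (isPosTrig_eulerFactor_sub_one h0 h1 l).star)
  convert h using 2 with t
  have hne := one_sub_ne_zero h0 h1 l t
  have hne' := one_sub_inv_ne_zero h0 h1 l t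
  have hz := exp_ne_zero (I * (l * t))
  have hr' : (1 - (r : ℂ) ^ 2) ≠ 0 := by exact_mod_cast hr.ne'
  rw [map_sub, map_one, conj_eulerFactor, eulerFactor]
  push_cast
  generalize exp (I * (l * t)) = z at *
  have hw : z * z⁻¹ = 1 := mul_inv_cancel₀ hz
  generalize z⁻¹ = w at *
  field_simp
  linear_combination ((r : ℂ) ^ 2) * hw

/-- The resonator `∏_{p ≤ N} (1 - (1 - p / N) p ^ (-i t))⁻¹`: the Dirichlet series of the completely
multiplicative function equal to `1 - p / N` at the primes `p ≤ N` and to `0` at the others. -/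
noncomputable def resonator (N : ℕ) (t : ℝ) : ℂ :=
  ∏ p ∈ N.primesLE, eulerFactor (1 - p / N) (-Real.log p) t

/-- The resonance weight, the squared modulus of the resonator. -/
noncomputable def weight (N : ℕ) (t : ℝ) : ℝ := ‖resonator N t‖ ^ 2

lemma weight_nonneg (N : ℕ) (t : ℝ) : 0 ≤ weight N t := by unfold weight; positivity

lemma ofReal_weight (N : ℕ) (t : ℝ) : (weight N t : ℂ) =
    ∏ p ∈ N.primesLE, (eulerFactor (1 - p / N) (-Real.log p) t *
      conj (eulerFactor (1 - p / N) (-Real.log p) t)) := by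
  rw [weight, ofReal_pow, ← mul_conj', resonator, map_prod, Finset.prod_mul_distrib]

lemma coeff_mem {N p : ℕ} (hp : p ∈ N.primesLE) :
    0 ≤ 1 - (p : ℝ) / N ∧ 1 - (p : ℝ) / N < 1 := by
  rw [Nat.mem_primesLE] at hp
  have h2 := hp.2.pos
  have h3 : (0 : ℝ) < p := by exact_mod_cast h2
  have h4 : (p : ℝ) ≤ N := by exact_mod_cast hp.1
  have h5 : (0 : ℝ) < p / N := div_pos h3 (h3.trans_le h4)
  have h6 : (p : ℝ) / N ≤ 1 := (div_le_one (h3.trans_le h4)).2 h4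
  constructor <;> linarith

lemma isPosTrig_weight (N : ℕ) : IsPosTrig (fun t ↦ (weight N t : ℂ)) := by
  simp only [ofReal_weight]
  exact IsPosTrig.prod _ fun p hp ↦
    isPosTrig_normSq_eulerFactor (coeff_mem hp).1 (coeff_mem hp).2 _

lemma continuous_weight (N : ℕ) : Continuous (weight N) := by
  exact continuous_re.comp (isPosTrig_weight N).continuous

/-- The constant term of the resonance weight, `∑ r(n)² = ∏ (1 - r(p)²)⁻¹`. -/
noncomputable def meanWeight (N : ℕ) : ℝ := ∏ p ∈ N.primesLE, (1 - (1 - (p : ℝ) / N) ^ 2)⁻¹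

lemma one_sub_sq_pos {r : ℝ} (h0 : 0 ≤ r) (h1 : r < 1) : 0 < 1 - r ^ 2 := by nlinarith

lemma meanWeight_pos (N : ℕ) : 0 < meanWeight N :=
  Finset.prod_pos fun _ hp ↦ inv_pos.2 (one_sub_sq_pos (coeff_mem hp).1 (coeff_mem hp).2)

lemma isPosTrig_weight_sub_mean (N : ℕ) :
    IsPosTrig (fun t ↦ (weight N t : ℂ) - (meanWeight N : ℂ)) := by
  simp only [ofReal_weight, meanWeight, ofReal_prod]
  have key : ∀ s : Finset ℕ, s ⊆ N.primesLE → IsPosTrig (fun t ↦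
      ∏ p ∈ s, (eulerFactor (1 - p / N) (-Real.log p) t *
      conj (eulerFactor (1 - p / N) (-Real.log p) t)) -
      ∏ p ∈ s, (((1 - (1 - (p : ℝ) / N) ^ 2)⁻¹ : ℝ) : ℂ)) := by
    intro s
    induction s using Finset.induction_on with
    | empty => intro _; simpa using IsPosTrig.const le_rfl
    | insert p s hp ih =>
      intro hs
      have hpN := hs (Finset.mem_insert_self p s)
      have h0 := (coeff_mem hpN).1
      have h1 := (coeff_mem hpN).2
      have hsN := (Finset.subset_insert p s).trans hs
      simp only [Finset.prod_insert hp]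
      have hc : IsPosTrig (fun _ ↦ ∏ p ∈ s, (((1 - (1 - (p : ℝ) / N) ^ 2)⁻¹ : ℝ) : ℂ)) :=
        IsPosTrig.prod s fun q hq ↦ IsPosTrig.const
          (inv_pos.2 (one_sub_sq_pos (coeff_mem (hsN hq)).1 (coeff_mem (hsN hq)).2)).le
      have h := ((isPosTrig_normSq_eulerFactor h0 h1 (-Real.log p)).mul (ih hsN)).add
        ((isPosTrig_normSq_sub h0 h1 (-Real.log p)).mul hc)
      convert h using 2 with t
      ring
  exact key _ subset_rfl

/-- For a prime power `d = p ^ k ≤ N`, the weight times `d ^ (-i t)` dominates coefficientwise the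
weight times `(1 - p / N) ^ k`, which is at least `1 - k p / N ≥ 1 - p ^ k / N`. -/
lemma isPosTrig_primePow_sub_mul_weight {N d : ℕ} (hd : IsPrimePow d) (hdN : d ≤ N) :
    IsPosTrig (fun t ↦ (exp (I * ((-Real.log d : ℝ) * t)) - ((1 - (d : ℝ) / N : ℝ) : ℂ)) *
      (weight N t : ℂ)) := by
  obtain ⟨p, k, hp, hk, rfl⟩ := hd
  have hp' := hp.nat_prime
  have hpk : p ≤ p ^ k := Nat.le_self_pow hk.ne' p
  have hpN : p ∈ N.primesLE := Nat.mem_primesLE.2 ⟨hpk.trans hdN, hp'⟩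
  obtain ⟨h0, h1⟩ := coeff_mem hpN
  have hN : (0 : ℝ) < N := by exact_mod_cast hp'.pos.trans_le (hpk.trans hdN)
  have hbern : 1 - ((p ^ k : ℕ) : ℝ) / N ≤ (1 - (p : ℝ) / N) ^ k := by
    have hb := one_add_mul_le_pow (a := -((p : ℝ) / N)) (by linarith) k
    rw [← sub_eq_add_neg] at hb
    refine le_trans ?_ hb
    have hkp : k * p ≤ p ^ k := by
      obtain ⟨m, rfl⟩ : ∃ m, k = m + 1 := ⟨k - 1, by omega⟩
      rw [pow_succ]
      exact Nat.mul_le_mul_right p (Nat.lt_pow_self hp'.one_lt)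
    have hkp' : (k : ℝ) * p ≤ ((p ^ k : ℕ) : ℝ) := by exact_mod_cast hkp
    have : (k : ℝ) * (p / N) ≤ ((p ^ k : ℕ) : ℝ) / N := by
      rw [← mul_div_assoc]; gcongr
    linarith
  have hrest := IsPosTrig.prod (N.primesLE.erase p)
    (F := fun q t ↦ eulerFactor (1 - q / N) (-Real.log q) t *
      conj (eulerFactor (1 - q / N) (-Real.log q) t)) fun q hq ↦
    isPosTrig_normSq_eulerFactor (coeff_mem (Finset.mem_of_mem_erase hq)).1
      (coeff_mem (Finset.mem_of_mem_erase hq)).2 _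
  have h := ((isPosTrig_pow_sub_mul_normSq h0 h1 (-Real.log p) k).mul hrest).add
    ((IsPosTrig.const (sub_nonneg.2 hbern)).mul (isPosTrig_weight N))
  convert h using 2 with t
  rw [ofReal_weight, ← Finset.mul_prod_erase _ _ hpN, ← exp_nat_mul]
  have : (I * ((-Real.log ((p ^ k : ℕ) : ℝ) : ℝ) * t) : ℂ) =
      k * (I * ((-Real.log p : ℝ) * t)) := by
    push_cast
    rw [Real.log_pow]
    push_cast
    ring
  rw [this]
  push_cast
  ring

/-! ### The logarithmic derivative against the resonance weight -/

open ArithmeticFunction in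
/-- On a line `Re s = σ > 1` the tail of the Dirichlet series of `-ζ'/ζ` has nonnegative
coefficients. -/
lemma isPosTrig_neg_logDeriv_sub {σ : ℝ} (hσ : 1 < σ) (N : ℕ) :
    IsPosTrig (fun t ↦ -deriv riemannZeta (σ + I * t) / riemannZeta (σ + I * t) -
      ∑ d ∈ Finset.Ioc 0 N, ((vonMangoldt d * (d : ℝ) ^ (-σ) : ℝ) : ℂ) *
        exp (I * ((-Real.log d : ℝ) * t))) := by
  have hterm : ∀ t : ℝ, ∀ n : ℕ, LSeries.term (fun n ↦ (vonMangoldt n : ℂ)) (σ + I * t) n =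
      ((vonMangoldt n * (n : ℝ) ^ (-σ) : ℝ) : ℂ) * exp (I * ((-Real.log n : ℝ) * t)) := by
    intro t n
    rcases eq_or_ne n 0 with rfl | hn
    · simp
    have hn' : (n : ℂ) ≠ 0 := by exact_mod_cast hn
    rw [LSeries.term_of_ne_zero hn, div_eq_mul_inv, ← cpow_neg, neg_add, cpow_add _ _ hn',
      ofReal_mul, ofReal_cpow (Nat.cast_nonneg n), mul_assoc]
    congr 2
    · push_cast; rfl
    · rw [cpow_def_of_ne_zero hn', ← natCast_log]
      push_cast
      ring_nf
  have hsum : ∀ t : ℝ, HasSum (fun n : ℕ ↦ ((vonMangoldt n * (n : ℝ) ^ (-σ) : ℝ) : ℂ) *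
      exp (I * ((-Real.log n : ℝ) * t)))
      (-deriv riemannZeta (σ + I * t) / riemannZeta (σ + I * t)) := by
    intro t
    have hs : 1 < (σ + I * t : ℂ).re := by simpa using hσ
    have h := (LSeriesSummable_vonMangoldt hs).hasSum
    rw [← LSeries_vonMangoldt_eq_deriv_riemannZeta_div hs, LSeries]
    exact h.congr_fun fun n ↦ (hterm t n).symm
  have h0 : ∀ n : ℕ, 0 ≤ vonMangoldt n * (n : ℝ) ^ (-σ) := fun n ↦
    mul_nonneg vonMangoldt_nonneg (by positivity)
  have hs : Summable fun n : ℕ ↦ vonMangoldt n * (n : ℝ) ^ (-σ) := by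
    have := (hsum 0).summable.norm
    simpa only [norm_mul_exp_I, abs_of_nonneg (h0 _)] using this
  have h := IsPosTrig.of_summable
    (a := fun n : {n // n ∉ Finset.Ioc 0 N} ↦ vonMangoldt n * ((n : ℕ) : ℝ) ^ (-σ))
    (l := fun n ↦ -Real.log (n : ℕ)) (fun n ↦ h0 n) (hs.subtype _)
  convert h using 2 with t
  rw [sub_eq_iff_eq_add', ← (hsum t).tsum_eq]
  exact ((hsum t).summable.sum_add_tsum_subtype_compl _).symm

open ArithmeticFunction in
/-- The resonance inequality on a line to the right of `Re s = 1`. -/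
lemma resonance_right {σ : ℝ} (hσ : 1 < σ) (N : ℕ) {T : ℝ} (hT : 0 < T) :
    (∑ d ∈ Finset.Ioc 0 N, vonMangoldt d * (d : ℝ) ^ (-σ) * (1 - d / N)) *
        ∫ t in (0 : ℝ)..T, (1 - t / T) * weight N t ≤
      ∫ t in (0 : ℝ)..T, (1 - t / T) *
        ((-deriv riemannZeta (σ + I * t) / riemannZeta (σ + I * t)).re * weight N t) := by
  have h1 := (isPosTrig_neg_logDeriv_sub hσ N).mul (isPosTrig_weight N)
  have h2 := IsPosTrig.sum (Finset.Ioc 0 N) (F := fun d t ↦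
      ((vonMangoldt d * (d : ℝ) ^ (-σ) : ℝ) : ℂ) *
        ((exp (I * ((-Real.log d : ℝ) * t)) - ((1 - (d : ℝ) / N : ℝ) : ℂ)) * (weight N t : ℂ))) <| by
    intro d hd
    by_cases hpp : IsPrimePow d
    · exact (IsPosTrig.const (mul_nonneg vonMangoldt_nonneg (by positivity))).mul
        (isPosTrig_primePow_sub_mul_weight hpp (Finset.mem_Ioc.1 hd).2)
    · simpa [vonMangoldt_eq_zero_iff.2 hpp] using IsPosTrig.const le_rfl
  have h3 := h1.add h2
  set S := ∑ d ∈ Finset.Ioc 0 N, vonMangoldt d * (d : ℝ) ^ (-σ) * (1 - d / N) with hS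
  have h4 : IsPosTrig fun t ↦ (-deriv riemannZeta (σ + I * t) / riemannZeta (σ + I * t) -
      (S : ℂ)) * (weight N t : ℂ) := by
    convert h3 using 2 with t
    rw [hS, sub_mul, sub_mul, sub_add]
    congr 1
    rw [ofReal_sum, Finset.sum_mul, Finset.sum_mul, ← Finset.sum_sub_distrib]
    refine Finset.sum_congr rfl fun d _ ↦ ?_
    push_cast
    ring
  have h5 := h4.integral_nonneg hT
  have hc : Continuous fun t : ℝ ↦
      (-deriv riemannZeta (σ + I * t) / riemannZeta (σ + I * t)).re := by
    have hd : Continuous fun t : ℝ ↦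
        ∑ d ∈ Finset.Ioc 0 N, ((vonMangoldt d * (d : ℝ) ^ (-σ) : ℝ) : ℂ) *
          exp (I * ((-Real.log d : ℝ) * t)) := by fun_prop
    have hc := continuous_re.comp ((isPosTrig_neg_logDeriv_sub hσ N).continuous.add hd)
    refine hc.congr fun t ↦ ?_
    simp only [Function.comp_apply, Pi.add_apply, sub_add_cancel]
  have hw := continuous_weight N
  rw [← intervalIntegral.integral_const_mul, ← sub_nonneg, ← intervalIntegral.integral_sub]
  · convert h5 using 3 with t
    rw [re_mul_ofReal, sub_re, ofReal_re]
    ring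
  · exact Continuous.intervalIntegrable (by fun_prop) _ _
  · exact Continuous.intervalIntegrable (by fun_prop) _ _

/-- The mean of the weight against the Fejér kernel is at least its constant term. -/
lemma mean_weight_le {T : ℝ} (hT : 0 < T) (N : ℕ) :
    meanWeight N * (T / 2) ≤ ∫ t in (0 : ℝ)..T, (1 - t / T) * weight N t := by
  have h := (isPosTrig_weight_sub_mean N).integral_nonneg hT
  have hw := continuous_weight N
  have hT2 : ∫ t in (0 : ℝ)..T, (1 - t / T) = T / 2 := by
    rw [intervalIntegral.integral_sub (by simp) (Continuous.intervalIntegrable (by fun_prop) _ _)]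
    simp only [intervalIntegral.integral_div, integral_id, intervalIntegral.integral_const]
    field_simp
    ring
  rw [← hT2, ← intervalIntegral.integral_const_mul, ← sub_nonneg, ← intervalIntegral.integral_sub]
  · convert h using 3 with t
    rw [sub_re, ofReal_re, ofReal_re]
    ring
  · exact Continuous.intervalIntegrable (by fun_prop) _ _
  · exact Continuous.intervalIntegrable (by fun_prop) _ _

/-! ### Passage to the line `Re s = 1` -/

lemma norm_eulerFactor_le {r : ℝ} (h0 : 0 ≤ r) (h1 : r < 1) (l t : ℝ) :
    ‖eulerFactor r l t‖ ≤ (1 - r)⁻¹ := by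
  rw [eulerFactor, norm_inv]
  refine inv_anti₀ (by linarith) ?_
  have h := norm_sub_norm_le (1 : ℂ) (r * exp (I * (l * t)))
  rwa [norm_one, norm_mul_exp_I, abs_of_nonneg h0] at h

lemma eulerFactor_at_zero (r l : ℝ) : eulerFactor r l 0 = (((1 - r)⁻¹ : ℝ) : ℂ) := by
  simp [eulerFactor]

lemma weight_le_weight_zero (N : ℕ) (t : ℝ) : weight N t ≤ weight N 0 := by
  unfold weight resonator
  gcongr 1
  rw [norm_prod, norm_prod]
  refine Finset.prod_le_prod (fun _ _ ↦ norm_nonneg _) fun p hp ↦ ?_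
  obtain ⟨h0, h1⟩ := coeff_mem hp
  rw [eulerFactor_at_zero, norm_real, Real.norm_eq_abs, abs_of_pos (inv_pos.2 (by linarith))]
  exact norm_eulerFactor_le h0 h1 _ t

lemma riemannZeta₁_ne_zero {s : ℂ} (hs : 1 ≤ s.re) : riemannZeta₁ s ≠ 0 := by
  rcases eq_or_ne s 1 with rfl | h1
  · simp
  · have h := riemannZeta_ne_zero_of_one_le_re hs
    rw [riemannZeta_eq_inv_sub_mul h1] at h
    exact right_ne_zero_of_mul h

lemma neg_logDeriv_zeta_eq {s : ℂ} (hs : 1 ≤ s.re) (h1 : s ≠ 1) :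
    -deriv riemannZeta s / riemannZeta s =
      (s - 1)⁻¹ - deriv riemannZeta₁ s / riemannZeta₁ s := by
  have h := riemannZeta₁_ne_zero hs
  have h2 : s - 1 ≠ 0 := sub_ne_zero.2 h1
  rw [deriv_riemannZeta_eq_neg_inv_sub_sq_mul_add h1, riemannZeta_eq_inv_sub_mul h1]
  field_simp
  ring

lemma re_inv_add_I_mul (δ t : ℝ) : ((δ + I * t : ℂ)⁻¹).re = δ / (δ ^ 2 + t ^ 2) := by
  rw [inv_re, normSq_apply]
  simp
  ring_nf

lemma integral_poisson_le {δ : ℝ} (hδ : 0 < δ) (T : ℝ) :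
    ∫ t in (0 : ℝ)..T, δ / (δ ^ 2 + t ^ 2) ≤ Real.pi / 2 := by
  have hd : ∀ t ∈ Set.uIcc 0 T, HasDerivAt (fun t ↦ Real.arctan (t / δ)) (δ / (δ ^ 2 + t ^ 2)) t := by
    intro t _
    refine ((hasDerivAt_id t).div_const δ).arctan.congr_deriv ?_
    have : δ ^ 2 + t ^ 2 ≠ 0 := by positivity
    have : 1 + (t / δ) ^ 2 ≠ 0 := by positivity
    simp only [id]
    field_simp
  have hc : Continuous fun t : ℝ ↦ δ / (δ ^ 2 + t ^ 2) :=
    Continuous.div (by fun_prop) (by fun_prop) fun t ↦ by positivity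
  rw [intervalIntegral.integral_eq_sub_of_hasDerivAt hd (hc.intervalIntegrable _ _)]
  simpa using (Real.arctan_lt_pi_div_two (T / δ)).le

/-- The negated real part of `ζ'/ζ` at `1 + |δ| + i t` without the contribution of the pole; the
absolute value makes it a continuous function of `δ` and `t`. -/
noncomputable def regularPart (δ t : ℝ) : ℝ :=
  -(deriv riemannZeta₁ (1 + |δ| + I * t) / riemannZeta₁ (1 + |δ| + I * t)).re

lemma continuous_regularPart : Continuous fun q : ℝ × ℝ ↦ regularPart q.1 q.2 := by
  have h1 : Continuous fun q : ℝ × ℝ ↦ (1 + |q.1| + I * q.2 : ℂ) := by fun_prop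
  have h2 : Continuous fun q : ℝ × ℝ ↦ deriv riemannZeta₁ (1 + |q.1| + I * q.2 : ℂ) :=
    differentiable_riemannZeta₁.deriv.continuous.comp h1
  have h3 : Continuous fun q : ℝ × ℝ ↦ riemannZeta₁ (1 + |q.1| + I * q.2 : ℂ) :=
    differentiable_riemannZeta₁.continuous.comp h1
  exact (continuous_re.comp (h2.div h3 fun q ↦ riemannZeta₁_ne_zero (by simp))).neg

/-- The pole of `ζ'/ζ` is invisible in the real part on the line `Re s = 1`. -/
lemma neg_re_logDeriv_eq_regularPart {t : ℝ} (ht : t ≠ 0) :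
    -(deriv riemannZeta (1 + I * (t : ℂ)) / riemannZeta (1 + I * (t : ℂ))).re =
      regularPart 0 t := by
  have h1 : (1 + I * t : ℂ) ≠ 1 := by simpa using ht
  have h := neg_logDeriv_zeta_eq (s := 1 + I * t) (by simp) h1
  have h2 := re_inv_add_I_mul 0 t
  rw [ofReal_zero, zero_add, zero_div] at h2
  rw [← neg_re, ← neg_div, h, sub_re, add_sub_cancel_left, h2, zero_sub, regularPart, abs_zero,
    ofReal_zero, add_zero]

lemma re_neg_logDeriv_eq {δ : ℝ} (hδ : 0 < δ) (t : ℝ) :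
    (-deriv riemannZeta ((1 + δ : ℝ) + I * t) / riemannZeta ((1 + δ : ℝ) + I * t)).re =
      regularPart δ t + δ / (δ ^ 2 + t ^ 2) := by
  have hne : ((1 + δ : ℝ) + I * t : ℂ) ≠ 1 := by
    intro h
    have := congrArg re h
    simp at this
    linarith
  rw [neg_logDeriv_zeta_eq (by simp [hδ.le]) hne, sub_re,
    show (((1 + δ : ℝ) : ℂ) + I * t - 1) = δ + I * t by push_cast; ring, re_inv_add_I_mul,
    regularPart, abs_of_pos hδ]
  push_cast
  ring

lemma continuous_poisson {δ : ℝ} (hδ : 0 < δ) : Continuous fun t : ℝ ↦ δ / (δ ^ 2 + t ^ 2) :=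
  Continuous.div (by fun_prop) (by fun_prop) fun t ↦ by positivity

lemma integral_weight_mul_poisson_le (N : ℕ) {T δ : ℝ} (hT : 0 < T) (hδ : 0 < δ) :
    ∫ t in (0 : ℝ)..T, (1 - t / T) * weight N t * (δ / (δ ^ 2 + t ^ 2)) ≤
      Real.pi / 2 * weight N 0 := by
  have hw := continuous_weight N
  have hP := continuous_poisson hδ
  calc _ ≤ ∫ t in (0 : ℝ)..T, weight N 0 * (δ / (δ ^ 2 + t ^ 2)) := by
        refine intervalIntegral.integral_mono_on hT.le
          (Continuous.intervalIntegrable (by fun_prop) _ _)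
          (Continuous.intervalIntegrable (by fun_prop) _ _) fun t ht ↦ ?_
        have h0 : 0 ≤ t / T := div_nonneg ht.1 hT.le
        have hp : 0 ≤ δ / (δ ^ 2 + t ^ 2) := by positivity
        refine mul_le_mul_of_nonneg_right ?_ hp
        nlinarith [weight_nonneg N t, weight_le_weight_zero N t]
    _ ≤ weight N 0 * (Real.pi / 2) := by
        rw [intervalIntegral.integral_const_mul]
        exact mul_le_mul_of_nonneg_left (integral_poisson_le hδ T) (weight_nonneg N 0)
    _ = _ := mul_comm _ _

open ArithmeticFunction in
lemma resonance_regularPart (N : ℕ) {T δ : ℝ} (hT : 0 < T) (hδ : 0 < δ) :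
    (∑ d ∈ Finset.Ioc 0 N, vonMangoldt d * (d : ℝ) ^ (-(1 + δ)) * (1 - d / N)) *
        (∫ t in (0 : ℝ)..T, (1 - t / T) * weight N t) - Real.pi / 2 * weight N 0 ≤
      ∫ t in (0 : ℝ)..T, (1 - t / T) * (regularPart δ t * weight N t) := by
  have hw := continuous_weight N
  have hP := continuous_poisson hδ
  have hR : Continuous (regularPart δ) :=
    Continuous.uncurry_left (f := regularPart) δ continuous_regularPart
  have h := resonance_right (σ := 1 + δ) (by linarith) N hT
  have hsplit : ∫ t in (0 : ℝ)..T, (1 - t / T) *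
      ((-deriv riemannZeta ((1 + δ : ℝ) + I * t) / riemannZeta ((1 + δ : ℝ) + I * t)).re *
        weight N t) = (∫ t in (0 : ℝ)..T, (1 - t / T) * (regularPart δ t * weight N t)) +
        ∫ t in (0 : ℝ)..T, (1 - t / T) * weight N t * (δ / (δ ^ 2 + t ^ 2)) := by
    rw [← intervalIntegral.integral_add (Continuous.intervalIntegrable (by fun_prop) _ _)
      (Continuous.intervalIntegrable (by fun_prop) _ _)]
    congr 1
    funext t
    rw [re_neg_logDeriv_eq hδ]
    ring
  rw [hsplit] at h
  have hpole := integral_weight_mul_poisson_le N hT hδ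
  linarith

open ArithmeticFunction in
/-- The resonance inequality on the line `Re s = 1`. The pole at `s = 1` costs at most
`π / 2` times the maximum of the weight. -/
lemma resonance_line (N : ℕ) {T : ℝ} (hT : 0 < T) :
    (∑ d ∈ Finset.Ioc 0 N, vonMangoldt d / d * (1 - d / N)) *
        (∫ t in (0 : ℝ)..T, (1 - t / T) * weight N t) - Real.pi / 2 * weight N 0 ≤
      ∫ t in (0 : ℝ)..T, (1 - t / T) * (regularPart 0 t * weight N t) := by
  have hw := continuous_weight N
  have hright := fun δ (hδ : 0 < δ) ↦ resonance_regularPart N hT hδ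
  set J := ∫ t in (0 : ℝ)..T, (1 - t / T) * weight N t with hJ
  have hlimL : Tendsto (fun δ : ℝ ↦ (∑ d ∈ Finset.Ioc 0 N, vonMangoldt d * (d : ℝ) ^ (-(1 + δ)) *
      (1 - d / N)) * J - Real.pi / 2 * weight N 0) (𝓝[>] 0)
      (𝓝 ((∑ d ∈ Finset.Ioc 0 N, vonMangoldt d / d * (1 - d / N)) * J -
        Real.pi / 2 * weight N 0)) := by
    refine Tendsto.mono_left ?_ nhdsWithin_le_nhds
    refine ((tendsto_finsetSum _ fun d hd ↦ ?_).mul_const _).sub_const _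
    have hd : (0 : ℝ) < d := by exact_mod_cast (Finset.mem_Ioc.1 hd).1
    have hcont : Continuous fun δ : ℝ ↦ vonMangoldt d * (d : ℝ) ^ (-(1 + δ)) * (1 - d / N) := by
      have : Continuous fun δ : ℝ ↦ (d : ℝ) ^ (-(1 + δ)) :=
        continuous_const.rpow (by fun_prop) fun _ ↦ Or.inl hd.ne'
      fun_prop
    have h := hcont.tendsto 0
    rwa [add_zero, Real.rpow_neg_one, ← div_eq_mul_inv] at h
  have hlimR : Tendsto (fun δ ↦ ∫ t in (0 : ℝ)..T, (1 - t / T) * (regularPart δ t * weight N t))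
      (𝓝[>] 0) (𝓝 (∫ t in (0 : ℝ)..T, (1 - t / T) * (regularPart 0 t * weight N t))) := by
    have h1 : Continuous fun q : ℝ × ℝ ↦ weight N q.2 := hw.comp continuous_snd
    have h2 := continuous_regularPart
    have h3 : Continuous fun q : ℝ × ℝ ↦ (1 - q.2 / T) * (regularPart q.1 q.2 * weight N q.2) := by
      fun_prop
    exact ((intervalIntegral.continuous_parametric_intervalIntegral_of_continuous' h3 0 T).tendsto
      0).mono_left nhdsWithin_le_nhds
  exact le_of_tendsto_of_tendsto hlimL hlimR
    (eventually_of_mem self_mem_nhdsWithin fun δ hδ ↦ hright δ hδ)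

/-! ### Size of `ζ` and `ζ'` near the line `Re s = 1` -/

/-- The primitive of `x ↦ log x * x ^ (-s)` tending to `0` at infinity when `1 < Re s`. -/
noncomputable def logCpowPrimitive (s : ℂ) (x : ℝ) : ℂ :=
  (x : ℂ) ^ (1 - s) * (Real.log x / (1 - s) - 1 / (1 - s) ^ 2)

lemma hasDerivAt_ofReal_cpow (s : ℂ) {x : ℝ} (hx : 0 < x) :
    HasDerivAt (fun x : ℝ ↦ (x : ℂ) ^ s) (s * (x : ℂ) ^ (s - 1)) x := by
  have h := (hasDerivAt_id (x : ℂ)).cpow_const (c := s) (Or.inl (by simpa using hx))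
  simpa using h.comp_ofReal

lemma hasDerivAt_logCpowPrimitive {s : ℂ} (hs : s ≠ 1) {x : ℝ} (hx : 0 < x) :
    HasDerivAt (logCpowPrimitive s) (Real.log x * (x : ℂ) ^ (-s)) x := by
  have h1 := hasDerivAt_ofReal_cpow (1 - s) hx
  have h2 := (Real.hasDerivAt_log hx.ne').ofReal_comp
  have hs' : 1 - s ≠ 0 := sub_ne_zero.2 hs.symm
  have hx' : (x : ℂ) ≠ 0 := by exact_mod_cast hx.ne'
  refine (h1.mul ((h2.div_const (1 - s)).sub_const (1 / (1 - s) ^ 2))).congr_deriv ?_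
  have h3 : (x : ℂ) ^ (1 - s) = x * (x : ℂ) ^ (-s) := by
    rw [sub_eq_add_neg, cpow_add _ _ hx', cpow_one]
  rw [h3, show (1 - s - 1) = -s by ring]
  push_cast
  field_simp
  ring

lemma hasDerivAt_log_mul_cpow (s : ℂ) {x : ℝ} (hx : 0 < x) :
    HasDerivAt (fun x : ℝ ↦ (Real.log x : ℂ) * (x : ℂ) ^ (-s))
      ((1 - s * Real.log x) * (x : ℂ) ^ (-s - 1)) x := by
  have h1 := hasDerivAt_ofReal_cpow (-s) hx
  have h2 := (Real.hasDerivAt_log hx.ne').ofReal_comp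
  have hx' : (x : ℂ) ≠ 0 := by exact_mod_cast hx.ne'
  refine (h2.mul h1).congr_deriv ?_
  have h3 : (x : ℂ) ^ (-s) = x * (x : ℂ) ^ (-s - 1) := by
    rw [cpow_sub _ _ hx', cpow_one]
    field_simp
  rw [h3]
  push_cast
  field_simp
  ring

/-- The error made in replacing a term of the series of `ζ'` by an integral. -/
lemma norm_log_mul_cpow_sub_le {s : ℂ} (hs : 1 < s.re) {n : ℕ} (hn : 1 ≤ n) :
    ‖(Real.log (n + 1 : ℝ) : ℂ) * ((n + 1 : ℝ) : ℂ) ^ (-s) -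
      (logCpowPrimitive s (n + 1) - logCpowPrimitive s n)‖ ≤
      (1 + ‖s‖) * ((1 + Real.log (n + 1)) / n ^ 2) := by
  have hn0 : (1 : ℝ) ≤ n := by exact_mod_cast hn
  have hs1 : s ≠ 1 := by rintro rfl; simp at hs
  set K := (1 + ‖s‖) * ((1 + Real.log (n + 1)) / n ^ 2) with hK
  set f : ℝ → ℂ := fun x ↦ (Real.log x : ℂ) * (x : ℂ) ^ (-s) with hf
  have hlog : 0 ≤ Real.log (n + 1) := Real.log_nonneg (by linarith)
  have hK0 : 0 ≤ K := by positivity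
  have hderiv : ∀ x ∈ Set.Icc (n : ℝ) (n + 1), ‖(1 - s * Real.log x) * (x : ℂ) ^ (-s - 1)‖ ≤ K := by
    intro x hx
    have hx0 : 0 < x := by linarith [hx.1]
    have hlx : 0 ≤ Real.log x := Real.log_nonneg (by linarith [hx.1])
    have hlx' : Real.log x ≤ Real.log (n + 1) := Real.log_le_log hx0 hx.2
    have h1 : ‖(1 - s * Real.log x : ℂ)‖ ≤ (1 + ‖s‖) * (1 + Real.log (n + 1)) := by
      calc ‖(1 - s * Real.log x : ℂ)‖ ≤ 1 + ‖s‖ * Real.log x := by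
            refine (norm_sub_le _ _).trans ?_
            rw [norm_one, norm_mul, norm_real, Real.norm_eq_abs, abs_of_nonneg hlx]
        _ ≤ (1 + ‖s‖) * (1 + Real.log (n + 1)) := by nlinarith [norm_nonneg s]
    have h2 : ‖(x : ℂ) ^ (-s - 1)‖ ≤ 1 / n ^ 2 := by
      rw [norm_cpow_eq_rpow_re_of_pos hx0]
      calc x ^ (-s - 1).re ≤ x ^ (-2 : ℝ) := by
            refine Real.rpow_le_rpow_of_exponent_le (by linarith [hx.1]) ?_
            simp; linarith
        _ = 1 / x ^ 2 := by rw [Real.rpow_neg hx0.le]; norm_num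
        _ ≤ 1 / n ^ 2 := by gcongr; exact hx.1
    rw [norm_mul, hK, ← mul_div_assoc, ← mul_one_div]
    gcongr
  have hvar : ∀ x ∈ Set.Icc (n : ℝ) (n + 1), ‖f (n + 1) - f x‖ ≤ K := by
    intro x hx
    have h := (convex_Icc (n : ℝ) (n + 1)).norm_image_sub_le_of_norm_hasDerivWithin_le
      (f := f) (fun y hy ↦ (hasDerivAt_log_mul_cpow s
        (by linarith [hy.1] : 0 < y)).hasDerivWithinAt) hderiv hx
        (Set.right_mem_Icc.2 (by linarith))
    refine h.trans ?_
    rw [Real.norm_eq_abs, abs_of_nonneg (by linarith [hx.2])]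
    nlinarith [hx.1]
  have h := (convex_Icc (n : ℝ) (n + 1)).norm_image_sub_le_of_norm_hasDerivWithin_le
      (f := fun x : ℝ ↦ x * f (n + 1) - logCpowPrimitive s x)
      (f' := fun x ↦ f (n + 1) - f x) (fun y hy ↦ ?_) hvar
      (Set.left_mem_Icc.2 (by linarith)) (Set.right_mem_Icc.2 (by linarith))
  · have h2 : ‖(n + 1 : ℝ) - n‖ = 1 := by simp
    rw [h2, mul_one] at h
    refine le_trans (le_of_eq ?_) h
    congr 1
    simp only [hf]
    push_cast
    ring
  · have hy0 : (0 : ℝ) < y := by linarith [hy.1]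
    have h3 : HasDerivAt (fun x : ℝ ↦ (x : ℂ) * f (n + 1)) (f (n + 1)) y := by
      simpa using (hasDerivAt_id y).ofReal_comp.mul_const (f (n + 1))
    exact (h3.sub (hasDerivAt_logCpowPrimitive hs1 hy0)).hasDerivWithinAt

/-- A telescoping majorant for the errors in `norm_log_mul_cpow_sub_le`. -/
lemma one_add_log_div_sq_le {n : ℕ} (hn : 1 ≤ n) :
    (1 + Real.log (n + 1)) / n ^ 2 ≤
      4 * (Real.log n + 2) / n - 4 * (Real.log (n + 1) + 2) / (n + 1) := by
  have hn0 : (1 : ℝ) ≤ n := by exact_mod_cast hn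
  have hl : 0 ≤ Real.log n := Real.log_nonneg hn0
  have h1 : Real.log (n + 1) ≤ Real.log n + 1 / n := by
    have h := Real.log_le_sub_one_of_pos (x := (n + 1) / n) (by positivity)
    rw [Real.log_div (by positivity) (by positivity)] at h
    have : ((n : ℝ) + 1) / n - 1 = 1 / n := by field_simp; ring
    linarith
  have h2 : (1 : ℝ) / n ≤ 1 := by rw [div_le_one (by linarith)]; exact hn0
  have h3 : n * Real.log (n + 1) ≤ n * Real.log n + 1 := by
    calc n * Real.log (n + 1) ≤ n * (Real.log n + 1 / n) := by gcongr
      _ = _ := by field_simp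
  rw [div_sub_div _ _ (by positivity) (by positivity), div_le_div_iff₀ (by positivity) (by positivity)]
  have h4 : 4 * (1 + Real.log n) ≤
      4 * (Real.log n + 2) * (n + 1) - n * (4 * (Real.log (n + 1) + 2)) := by nlinarith
  have h5 : (1 + Real.log (n + 1)) * (n + 1) ≤ 4 * (1 + Real.log n) * n := by nlinarith
  calc (1 + Real.log (n + 1)) * (n * (n + 1)) = n * ((1 + Real.log (n + 1)) * (n + 1)) := by ring
    _ ≤ n * (4 * (1 + Real.log n) * n) := by gcongr
    _ = 4 * (1 + Real.log n) * n ^ 2 := by ring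
    _ ≤ _ := by gcongr

lemma hasSum_neg_deriv_riemannZeta {s : ℂ} (hs : 1 < s.re) :
    HasSum (fun n : ℕ ↦ (Real.log (n + 1 : ℝ) : ℂ) * ((n + 1 : ℝ) : ℂ) ^ (-s))
      (-deriv riemannZeta s) := by
  have ha : LSeries.abscissaOfAbsConv 1 < s.re := by
    rw [LSeries.abscissaOfAbsConv_one]; exact_mod_cast hs
  have h1 : deriv riemannZeta s = deriv (LSeries 1) s := by
    refine EventuallyEq.deriv_eq ?_
    filter_upwards [(isOpen_lt continuous_const continuous_re).mem_nhds hs] with z hz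
    exact (LSeries_one_eq_riemannZeta hz).symm
  have h2 := (LSeriesSummable_logMul_of_lt_re ha).hasSum
  rw [h1, LSeries_deriv ha, neg_neg, LSeries]
  rw [← hasSum_nat_add_iff' 1] at h2
  simp only [Finset.range_one, Finset.sum_singleton, LSeries.term_zero, sub_zero] at h2
  refine h2.congr_fun fun n ↦ ?_
  have hlog : ((Real.log (n + 1 : ℝ) : ℝ) : ℂ) = log ((n + 1 : ℕ) : ℂ) := by
    rw [← natCast_log]; push_cast; rfl
  rw [LSeries.term_of_ne_zero (Nat.succ_ne_zero n), cpow_neg, div_eq_mul_inv, hlog]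
  simp [LSeries.logMul]

lemma tendsto_logCpowPrimitive {s : ℂ} (hs : 1 < s.re) :
    Tendsto (fun M : ℕ ↦ ‖logCpowPrimitive s M‖) atTop (𝓝 0) := by
  have h1 : Tendsto (fun x : ℝ ↦ Real.log x * x ^ (1 - s.re)) atTop (𝓝 0) := by
    have h := (isLittleO_log_rpow_atTop (sub_pos.2 hs)).tendsto_div_nhds_zero
    refine h.congr' ?_
    filter_upwards [eventually_gt_atTop 0] with x hx
    rw [div_eq_mul_inv, ← Real.rpow_neg hx.le, neg_sub]
  have h2 : Tendsto (fun x : ℝ ↦ x ^ (1 - s.re)) atTop (𝓝 0) := by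
    have := tendsto_rpow_neg_atTop (sub_pos.2 hs)
    simpa only [neg_sub] using this
  have h3 := ((h1.mul_const (1 / ‖1 - s‖)).add (h2.mul_const (1 / ‖1 - s‖ ^ 2))).comp
    tendsto_natCast_atTop_atTop
  rw [zero_mul, zero_mul, add_zero] at h3
  refine squeeze_zero' (Eventually.of_forall fun _ ↦ norm_nonneg _) ?_ h3
  filter_upwards [eventually_ge_atTop 1] with M hM
  have hM0 : (1 : ℝ) ≤ M := by exact_mod_cast hM
  rw [logCpowPrimitive, norm_mul, norm_cpow_eq_rpow_re_of_pos (by linarith)]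
  simp only [Function.comp_apply]
  calc (M : ℝ) ^ (1 - s).re * ‖(Real.log M / (1 - s) - 1 / (1 - s) ^ 2 : ℂ)‖
      ≤ (M : ℝ) ^ (1 - s).re * (Real.log M / ‖1 - s‖ + 1 / ‖1 - s‖ ^ 2) := by
        gcongr
        refine (norm_sub_le _ _).trans_eq ?_
        rw [norm_div, norm_div, norm_pow, norm_real, norm_one, Real.norm_eq_abs,
          abs_of_nonneg (Real.log_nonneg hM0)]
    _ = _ := by rw [sub_re, one_re]; ring

/-- The series of `ζ'` is cut at `N ≈ t`: the terms up to `N` are bounded trivially, and the others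
are compared with an integral, the total error being `O(|s| log N / N)`. -/
lemma norm_deriv_riemannZeta_le_of_one_lt {σ t : ℝ} (hσ : 1 < σ) (hσ2 : σ ≤ 2) (ht : 1 ≤ t) :
    ‖deriv riemannZeta (σ + I * t)‖ ≤ 28 * Real.log (t + 3) ^ 2 := by
  set s : ℂ := σ + I * t with hs_def
  have hre : s.re = σ := by simp [hs_def]
  have him : s.im = t := by simp [hs_def]
  have hs : 1 < s.re := by rwa [hre]
  set L := Real.log (t + 3) with hL
  set N : ℕ := ⌊t⌋₊ + 3 with hN
  have hfl : (⌊t⌋₊ : ℝ) ≤ t := Nat.floor_le (by linarith)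
  have hfl' : t < ⌊t⌋₊ + 1 := Nat.lt_floor_add_one t
  have hNt : (N : ℝ) ≤ t + 3 := by rw [hN]; push_cast; linarith
  have htN : t + 2 < N := by rw [hN]; push_cast; linarith
  have hN3 : (3 : ℝ) < N := by linarith
  have hN1 : 1 ≤ N := by omega
  have hlogN : Real.log N ≤ L := Real.log_le_log (by linarith) hNt
  have hlogN0 : 0 ≤ Real.log N := Real.log_nonneg (by linarith)
  have hL1 : 1 ≤ L := by
    rw [hL, Real.le_log_iff_exp_le (by linarith)]
    linarith [Real.exp_one_lt_d9]
  have hs_norm : ‖s‖ ≤ 2 + t := by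
    refine (norm_le_abs_re_add_abs_im s).trans ?_
    rw [hre, him, abs_of_pos (by linarith), abs_of_pos (by linarith)]
    linarith
  have hs_sub : 1 ≤ ‖1 - s‖ := by
    refine le_trans ?_ (abs_im_le_norm (1 - s))
    rw [sub_im, one_im, him, zero_sub, abs_neg, abs_of_pos (by linarith)]
    exact ht
  -- The terms up to `N` are bounded trivially.
  have hhead : ‖∑ n ∈ Finset.range N, (Real.log (n + 1 : ℝ) : ℂ) * ((n + 1 : ℝ) : ℂ) ^ (-s)‖ ≤
      L * (1 + L) := by
    calc _ ≤ ∑ n ∈ Finset.range N, L * ((n : ℝ) + 1)⁻¹ := by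
          refine norm_sum_le_of_le _ fun n hn ↦ ?_
          have hnN : (n : ℝ) + 1 ≤ N := by exact_mod_cast Finset.mem_range.1 hn
          have hn0 : (0 : ℝ) ≤ n := Nat.cast_nonneg n
          have hl0 : 0 ≤ Real.log (n + 1) := Real.log_nonneg (by linarith)
          rw [norm_mul, norm_real, Real.norm_eq_abs, abs_of_nonneg hl0,
            norm_cpow_eq_rpow_re_of_pos (by linarith)]
          have h1 : Real.log (n + 1) ≤ L := (Real.log_le_log (by linarith) hnN).trans hlogN
          have h2 : ((n : ℝ) + 1) ^ (-s).re ≤ ((n : ℝ) + 1)⁻¹ := by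
            rw [← Real.rpow_neg_one]
            refine Real.rpow_le_rpow_of_exponent_le (by linarith) ?_
            rw [neg_re]; linarith
          gcongr
      _ = L * ((harmonic N : ℚ) : ℝ) := by
          rw [← Finset.mul_sum, harmonic]
          push_cast
          rfl
      _ ≤ L * (1 + L) := by
          have := harmonic_le_one_add_log N
          gcongr
          linarith
  have hprim : ‖logCpowPrimitive s N‖ ≤ L + 1 := by
    rw [logCpowPrimitive, norm_mul, norm_cpow_eq_rpow_re_of_pos (by linarith)]
    have h1 : (N : ℝ) ^ (1 - s).re ≤ 1 := by
      refine Real.rpow_le_one_of_one_le_of_nonpos (by linarith) ?_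
      rw [sub_re, one_re]; linarith
    have h2 : ‖(Real.log N / (1 - s) - 1 / (1 - s) ^ 2 : ℂ)‖ ≤ L + 1 := by
      refine (norm_sub_le _ _).trans ?_
      rw [norm_div, norm_div, norm_pow, norm_real, norm_one, Real.norm_eq_abs,
        abs_of_nonneg hlogN0]
      have h3 : Real.log N / ‖1 - s‖ ≤ Real.log N := div_le_self hlogN0 hs_sub
      have h4 : 1 / ‖1 - s‖ ^ 2 ≤ 1 := div_le_self zero_le_one (one_le_pow₀ hs_sub)
      linarith
    calc _ ≤ 1 * (L + 1) := by gcongr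
      _ = _ := one_mul _
  set u : ℕ → ℝ := fun n ↦ 4 * (Real.log n + 2) / n with hu
  have htail : ∀ k : ℕ, ‖∑ n ∈ Finset.range k, (Real.log ((N + n : ℕ) + 1 : ℝ) : ℂ) *
      (((N + n : ℕ) + 1 : ℝ) : ℂ) ^ (-s) - (logCpowPrimitive s (N + k : ℕ) - logCpowPrimitive s N)‖ ≤
      (1 + ‖s‖) * (u N - u (N + k)) := by
    intro k
    induction k with
    | zero => simp
    | succ k ih =>
      have h1 := norm_log_mul_cpow_sub_le hs (n := N + k) (by omega)
      have h2 := one_add_log_div_sq_le (n := N + k) (by omega)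
      rw [Finset.sum_range_succ]
      have h3 : u (N + (k + 1)) = 4 * (Real.log ((N + k : ℕ) + 1) + 2) / ((N + k : ℕ) + 1) := by
        simp only [hu]; push_cast; ring_nf
      have h4 : logCpowPrimitive s (N + (k + 1) : ℕ) = logCpowPrimitive s ((N + k : ℕ) + 1) := by
        push_cast; ring_nf
      rw [h4, show ∀ a b c d e : ℂ, a + b - (c - d) = (a - (e - d)) + (b - (c - e)) from
        fun a b c d e ↦ by ring]
      refine (norm_add_le_of_le ih h1).trans ?_
      rw [h3, ← mul_add]
      refine mul_le_mul_of_nonneg_left ?_ (by positivity)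
      simp only [hu] at *
      linarith
  have hpart : ∀ k : ℕ, ‖∑ n ∈ Finset.range (N + k), (Real.log (n + 1 : ℝ) : ℂ) *
      ((n + 1 : ℝ) : ℂ) ^ (-s)‖ ≤ 28 * L ^ 2 + ‖logCpowPrimitive s (N + k : ℕ)‖ := by
    intro k
    have hu0 : 0 ≤ u (N + k) := by simp only [hu]; positivity
    have huN : (1 + ‖s‖) * u N ≤ 8 * (L + 2) := by
      have h1 : 1 + ‖s‖ ≤ 2 * N := by linarith
      calc (1 + ‖s‖) * u N ≤ 2 * N * (4 * (L + 2) / N) := by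
            simp only [hu]; gcongr
        _ = 8 * (L + 2) := by field_simp; ring
    have h1 := htail k
    rw [Finset.sum_range_add]
    set A := ∑ n ∈ Finset.range k, (Real.log ((N + n : ℕ) + 1 : ℝ) : ℂ) *
      (((N + n : ℕ) + 1 : ℝ) : ℂ) ^ (-s)
    have h2 : ‖A‖ ≤ 8 * (L + 2) + (‖logCpowPrimitive s (N + k : ℕ)‖ + (L + 1)) := by
      have h3 : A = (A - (logCpowPrimitive s (N + k : ℕ) - logCpowPrimitive s N)) +
        (logCpowPrimitive s (N + k : ℕ) - logCpowPrimitive s N) := by ring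
      rw [h3]
      refine norm_add_le_of_le (h1.trans ?_) ((norm_sub_le _ _).trans (by gcongr))
      have : 0 ≤ (1 + ‖s‖) * u (N + k) := by positivity
      linarith
    refine (norm_add_le_of_le hhead h2).trans ?_
    nlinarith
  have hlim := ((hasSum_neg_deriv_riemannZeta hs).tendsto_sum_nat.comp
    (tendsto_add_atTop_nat N)).norm
  have hlim2 := ((tendsto_logCpowPrimitive hs).comp (tendsto_add_atTop_nat N)).const_add
    (28 * L ^ 2)
  have := le_of_tendsto_of_tendsto' hlim hlim2 fun k ↦ by
    simpa only [Function.comp_apply, add_comm N k] using hpart k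
  simpa using this

lemma continuous_comp_horizontal {f : ℂ → ℂ} (hf : ∀ s : ℂ, s ≠ 1 → ContinuousAt f s) {t : ℝ} (ht : t ≠ 0) :
    Continuous fun σ : ℝ ↦ f (σ + I * t) := by
  refine continuous_iff_continuousAt.2 fun σ ↦ ContinuousAt.comp (hf _ ?_) (by fun_prop)
  intro h
  have := congrArg im h
  simp [ht] at this

lemma continuousAt_deriv_riemannZeta {s : ℂ} (hs : s ≠ 1) : ContinuousAt (deriv riemannZeta) s :=
  ((differentiableOn_riemannZeta.analyticOnNhd isOpen_compl_singleton).deriv s hs).continuousAt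

/-- `ζ'(σ + i t) = O(log² t)` uniformly for `1 ≤ σ ≤ 2`. -/
lemma norm_deriv_riemannZeta_le {σ t : ℝ} (hσ : 1 ≤ σ) (hσ2 : σ ≤ 2) (ht : 1 ≤ t) :
    ‖deriv riemannZeta (σ + I * t)‖ ≤ 28 * Real.log (t + 3) ^ 2 := by
  rcases hσ.eq_or_lt with rfl | hσ
  · have hc := (continuous_comp_horizontal (fun s hs ↦ continuousAt_deriv_riemannZeta hs)
      (by linarith : t ≠ 0)).norm
    refine le_of_tendsto ((hc.tendsto 1).mono_left (nhdsWithin_le_nhds (s := Set.Ioi 1))) ?_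
    filter_upwards [Ioc_mem_nhdsGT (by norm_num : (1 : ℝ) < 2)] with σ hσ
    exact norm_deriv_riemannZeta_le_of_one_lt hσ.1 hσ.2 ht
  · exact norm_deriv_riemannZeta_le_of_one_lt hσ hσ2 ht

/-- The mean value inequality for `ζ` along a horizontal segment. -/
lemma norm_riemannZeta_sub_le {a b t : ℝ} (ha : 1 ≤ a) (hab : a ≤ b) (hb : b ≤ 2) (ht : 1 ≤ t) :
    ‖riemannZeta (b + I * t) - riemannZeta (a + I * t)‖ ≤ 28 * Real.log (t + 3) ^ 2 * (b - a) := by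
  have h := (convex_Icc a b).norm_image_sub_le_of_norm_hasDerivWithin_le
    (f := fun σ : ℝ ↦ riemannZeta (σ + I * t)) (f' := fun σ ↦ deriv riemannZeta (σ + I * t))
    (fun σ hσ ↦ ?_) (fun σ hσ ↦ norm_deriv_riemannZeta_le (ha.trans hσ.1) (hσ.2.trans hb) ht)
    (Set.left_mem_Icc.2 hab) (Set.right_mem_Icc.2 hab)
  · rwa [Real.norm_eq_abs, abs_of_nonneg (sub_nonneg.2 hab)] at h
  · have hne : (σ + I * t : ℂ) ≠ 1 := by
      intro h
      have := congrArg im h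
      simp at this
      linarith
    have h1 : HasDerivAt (fun z : ℂ ↦ z + I * t) 1 (σ : ℂ) := (hasDerivAt_id _).add_const _
    have h2 := ((differentiableAt_riemannZeta hne).hasDerivAt.comp (σ : ℂ) h1).comp_ofReal
    rw [mul_one] at h2
    exact h2.hasDerivWithinAt

/-- `ζ(σ + i t) = O(log² t)` uniformly for `1 ≤ σ ≤ 2`. -/
lemma exists_norm_riemannZeta_le : ∃ C : ℝ, 0 < C ∧ ∀ σ t : ℝ, 1 ≤ σ → σ ≤ 2 → 1 ≤ t →
    ‖riemannZeta (σ + I * t)‖ ≤ C * Real.log (t + 3) ^ 2 := by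
  set K := ∑' n : ℕ, 1 / ((n : ℝ) + 1) ^ 2 with hK
  have hsumm : Summable fun n : ℕ ↦ 1 / ((n : ℝ) + 1) ^ 2 := by
    have := (summable_nat_add_iff 1).2 (Real.summable_one_div_nat_pow.2 one_lt_two)
    simpa using this
  have hK0 : 0 ≤ K := tsum_nonneg fun n ↦ by positivity
  refine ⟨K + 28, by linarith, fun σ t hσ hσ2 ht ↦ ?_⟩
  have hL1 : 1 ≤ Real.log (t + 3) := by
    rw [Real.le_log_iff_exp_le (by linarith)]
    linarith [Real.exp_one_lt_d9]
  have h2 : ‖riemannZeta ((2 : ℝ) + I * t)‖ ≤ K := by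
    rw [zeta_eq_tsum_one_div_nat_add_one_cpow (by simp)]
    refine tsum_of_norm_bounded hsumm.hasSum fun n ↦ le_of_eq ?_
    have : ((n : ℂ) + 1) = ((n + 1 : ℝ) : ℂ) := by push_cast; rfl
    rw [this, norm_div, norm_one, norm_cpow_eq_rpow_re_of_pos (by positivity)]
    simp
  have h3 := norm_riemannZeta_sub_le hσ hσ2 le_rfl ht
  have h4 : ‖riemannZeta (σ + I * t)‖ ≤ ‖riemannZeta ((2 : ℝ) + I * t)‖ +
      ‖riemannZeta ((2 : ℝ) + I * t) - riemannZeta (σ + I * t)‖ := by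
    rw [norm_sub_rev]
    exact norm_le_norm_add_norm_sub' _ _
  have h5 : 28 * Real.log (t + 3) ^ 2 * (2 - σ) ≤ 28 * Real.log (t + 3) ^ 2 := by
    nlinarith [sq_nonneg (Real.log (t + 3))]
  have h6 : 1 ≤ Real.log (t + 3) ^ 2 := one_le_pow₀ hL1
  nlinarith

lemma exists_riemannZeta_le_div : ∃ C : ℝ, 0 < C ∧ ∀ δ : ℝ, 0 < δ → δ ≤ 1 →
    ‖riemannZeta (1 + δ)‖ ≤ C / δ := by
  have hc : Continuous fun δ : ℝ ↦ ‖riemannZeta₁ (1 + δ)‖ :=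
    (differentiable_riemannZeta₁.continuous.comp (by fun_prop)).norm
  obtain ⟨C, hC⟩ := (isCompact_Icc (a := (0 : ℝ)) (b := 1)).bddAbove_image hc.continuousOn
  have hC' : ∀ δ : ℝ, 0 ≤ δ → δ ≤ 1 → ‖riemannZeta₁ (1 + δ)‖ ≤ C := fun δ h0 h1 ↦
    hC ⟨δ, ⟨h0, h1⟩, rfl⟩
  refine ⟨C, ?_, fun δ h0 h1 ↦ ?_⟩
  · have := hC' 0 le_rfl zero_le_one
    simp at this
    linarith
  · have hδ : (δ : ℂ) ≠ 0 := by exact_mod_cast h0.ne'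
    rw [riemannZeta_eq_inv_sub_mul (by simpa using hδ), add_sub_cancel_left, norm_mul, norm_inv,
      norm_real, Real.norm_eq_abs, abs_of_pos h0, inv_mul_eq_div]
    gcongr
    exact hC' δ h0.le h1

/-- The classical inequality from `3 + 4 cos φ + cos 2φ ≥ 0`. -/
lemma zeta_product_ge_one {δ : ℝ} (hδ : 0 < δ) (t : ℝ) :
    1 ≤ ‖riemannZeta (1 + δ)‖ ^ 3 * ‖riemannZeta ((1 + δ : ℝ) + I * t)‖ ^ 4 *
      ‖riemannZeta ((1 + δ : ℝ) + I * (2 * t : ℝ))‖ := by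
  have h := DirichletCharacter.norm_LFunction_product_ge_one (N := 1) (1 : DirichletCharacter ℂ 1)
    hδ t
  rw [DirichletCharacter.LFunctionTrivChar, DirichletCharacter.LFunction_modOne_eq,
    DirichletCharacter.LFunction_modOne_eq, norm_mul, norm_mul, norm_pow, norm_pow] at h
  convert h using 4
  · push_cast; rfl
  · push_cast; ring

/-- A quantitative form of the nonvanishing of `ζ` on the line `Re s = 1`, from
`ζ(σ)³ |ζ(σ + i t)|⁴ |ζ(σ + 2 i t)| ≥ 1` with `σ - 1` of order `log ^ (-10) t`. -/
lemma exists_le_norm_riemannZeta : ∃ c : ℝ, 0 < c ∧ ∀ t : ℝ, 1 ≤ t →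
    c / Real.log (t + 3) ^ 8 ≤ ‖riemannZeta (1 + I * t)‖ := by
  obtain ⟨C₁, hC₁, h1⟩ := exists_riemannZeta_le_div
  obtain ⟨C₂, hC₂, h2⟩ := exists_norm_riemannZeta_le
  set C := C₁ ^ 3 * (4 * C₂) + 1 with hC
  have hCpos : 1 ≤ C := by rw [hC]; have : 0 < C₁ ^ 3 * (4 * C₂) := by positivity
                           linarith
  set c := 1 / (56 ^ 4 * C) with hc
  have hc0 : 0 < c := by positivity
  have hcC : 56 ^ 4 * C * c = 1 := by rw [hc]; field_simp
  have hc1 : c ≤ 1 := by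
    rw [hc, div_le_one (by positivity)]
    linarith
  refine ⟨28 * c, by positivity, fun t ht ↦ ?_⟩
  set L := Real.log (t + 3) with hL
  have hL1 : 1 ≤ L := by
    rw [hL, Real.le_log_iff_exp_le (by linarith)]
    linarith [Real.exp_one_lt_d9]
  have hL0 : 0 < L := by linarith
  have hL2 : Real.log (2 * t + 3) ≤ 2 * L := by
    have : Real.log (2 * t + 3) ≤ Real.log ((t + 3) ^ 2) :=
      Real.log_le_log (by linarith) (by nlinarith)
    rwa [Real.log_pow] at this
  -- This `δ` makes the lower bound `δ ^ (3/4) L ^ (-1/2)` for `|ζ(1 + δ + i t)|` and the change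
  -- `L ^ 2 δ` of `ζ` over `[1, 1 + δ]` both of order `L ^ (-8)`.
  set δ := c / L ^ 10 with hδ
  have hδ0 : 0 < δ := by positivity
  have hδ1 : δ ≤ 1 := by
    rw [hδ, div_le_one (by positivity)]
    exact hc1.trans (one_le_pow₀ hL1)
  set a := ‖riemannZeta ((1 + δ : ℝ) + I * t)‖ with ha
  have hprod := zeta_product_ge_one hδ0 t
  have hz2 : ‖riemannZeta ((1 + δ : ℝ) + I * (2 * t : ℝ))‖ ≤ C₂ * (2 * L) ^ 2 := by
    refine (h2 (1 + δ) (2 * t) (by linarith) (by linarith) (by linarith)).trans ?_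
    have : 0 ≤ Real.log (2 * t + 3) := Real.log_nonneg (by linarith)
    gcongr
  have ha4 : δ ^ 3 ≤ C * L ^ 2 * a ^ 4 := by
    have h3 : 1 ≤ (C₁ / δ) ^ 3 * a ^ 4 * (C₂ * (2 * L) ^ 2) := by
      refine hprod.trans ?_
      gcongr
      exact h1 δ hδ0 hδ1
    have h4 : δ ^ 3 * ((C₁ / δ) ^ 3 * a ^ 4 * (C₂ * (2 * L) ^ 2)) =
        C₁ ^ 3 * (4 * C₂) * (L ^ 2 * a ^ 4) := by field_simp; ring
    have h5 : 0 ≤ L ^ 2 * a ^ 4 := by positivity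
    calc δ ^ 3 ≤ δ ^ 3 * ((C₁ / δ) ^ 3 * a ^ 4 * (C₂ * (2 * L) ^ 2)) :=
          le_mul_of_one_le_right (by positivity) h3
      _ = C₁ ^ 3 * (4 * C₂) * (L ^ 2 * a ^ 4) := h4
      _ ≤ C * (L ^ 2 * a ^ 4) := by gcongr; linarith
      _ = _ := by ring
  have hlow : 56 * c / L ^ 8 ≤ a := by
    refine le_of_pow_le_pow_left₀ (n := 4) (by norm_num) (norm_nonneg _) ?_
    have h6 : (56 * c / L ^ 8) ^ 4 * (C * L ^ 2) = δ ^ 3 := by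
      have : (56 * c / L ^ 8) ^ 4 * (C * L ^ 2) = (56 ^ 4 * C * c) * (c / L ^ 10) ^ 3 := by
        field_simp
      rw [this, hcC, one_mul]
    have h7 : 0 < C * L ^ 2 := by positivity
    rw [← mul_le_mul_iff_left₀ h7, h6]
    linarith
  have hdiff := norm_riemannZeta_sub_le (a := 1) (b := 1 + δ) le_rfl (by linarith) (by linarith) ht
  have h8 : 28 * L ^ 2 * (1 + δ - 1) = 28 * c / L ^ 8 := by
    rw [add_sub_cancel_left, hδ]; field_simp
  rw [h8] at hdiff
  have h9 : a ≤ ‖riemannZeta (1 + I * t)‖ +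
      ‖riemannZeta ((1 + δ : ℝ) + I * t) - riemannZeta ((1 : ℝ) + I * t)‖ := by
    have := norm_le_norm_add_norm_sub' (riemannZeta ((1 + δ : ℝ) + I * t))
      (riemannZeta ((1 : ℝ) + I * t))
    simpa only [ofReal_one] using this
  have h10 : 56 * c / L ^ 8 = 28 * c / L ^ 8 + 28 * c / L ^ 8 := by ring
  linarith

/-- `ζ'/ζ (1 + i t)` has at most logarithmic growth, and its real part stays bounded near
`t = 0`. -/
lemma exists_abs_regularPart_le : ∃ C : ℝ, 0 < C ∧ ∀ t : ℝ, 0 < t →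
    |regularPart 0 t| ≤ C * Real.log (t + 3) ^ 10 := by
  obtain ⟨c, hc, hlow⟩ := exists_le_norm_riemannZeta
  have hcont : Continuous fun t : ℝ ↦ |regularPart 0 t| :=
    (Continuous.uncurry_left (f := regularPart) 0 continuous_regularPart).abs
  obtain ⟨K, hK⟩ := (isCompact_Icc (a := (0 : ℝ)) (b := 1)).bddAbove_image hcont.continuousOn
  have hK' : ∀ t : ℝ, 0 ≤ t → t ≤ 1 → |regularPart 0 t| ≤ K := fun t h0 h1 ↦
    hK ⟨t, ⟨h0, h1⟩, rfl⟩
  have hK0 : 0 ≤ K := (abs_nonneg _).trans (hK' 0 le_rfl zero_le_one)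
  refine ⟨K + 28 / c, by positivity, fun t ht ↦ ?_⟩
  set L := Real.log (t + 3) with hL
  have hL1 : 1 ≤ L := by
    rw [hL, Real.le_log_iff_exp_le (by linarith)]
    linarith [Real.exp_one_lt_d9]
  have hL0 : 0 < L := by linarith
  have hL10 : 1 ≤ L ^ 10 := one_le_pow₀ hL1
  rcases le_total t 1 with h | h
  · have h2 : 0 ≤ 28 / c * L ^ 10 := by positivity
    nlinarith [hK' t ht.le h]
  · have h1 := norm_deriv_riemannZeta_le (σ := 1) le_rfl (by norm_num) h
    rw [ofReal_one] at h1
    calc |regularPart 0 t| ≤ ‖deriv riemannZeta (1 + I * t) / riemannZeta (1 + I * t)‖ := by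
          rw [← neg_re_logDeriv_eq_regularPart ht.ne', abs_neg]
          exact abs_re_le_norm _
      _ ≤ 28 * L ^ 2 / (c / L ^ 8) := by
          rw [norm_div]
          gcongr
          exact hlow t h
      _ = 28 / c * L ^ 10 := by field_simp
      _ ≤ _ := by
          have : 0 ≤ K * L ^ 10 := by positivity
          nlinarith

end LargeValues

namespace LargeValues

open Filter Topology MeasureTheory ArithmeticFunction

/-! ### Chebyshev-type estimates for the von Mangoldt function -/

lemma log_factorial_eq_sum_vonMangoldt (m : ℕ) :
    Real.log (m.factorial : ℝ) = ∑ d ∈ Finset.Ioc 0 m, vonMangoldt d * ((m / d : ℕ) : ℝ) := by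
  rw [← sum_Ioc_mul_zeta_eq_sum, vonMangoldt_mul_zeta]
  induction m with
  | zero => simp
  | succ m ih =>
    rw [Finset.sum_Ioc_succ_top (Nat.zero_le m), ← ih, Nat.factorial_succ, Nat.cast_mul,
      Real.log_mul (by positivity) (by positivity), log_apply, add_comm]

lemma le_log_factorial (m : ℕ) : m * Real.log m - m ≤ Real.log (m.factorial : ℝ) := by
  induction m with
  | zero => simp
  | succ m ih =>
    rw [Nat.factorial_succ, Nat.cast_mul, Real.log_mul (by positivity) (by positivity)]
    rcases Nat.eq_zero_or_pos m with rfl | hm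
    · simp
    have hm0 : (0 : ℝ) < m := by exact_mod_cast hm
    have h := Real.log_le_sub_one_of_pos (x := ((m : ℝ) + 1) / m) (by positivity)
    rw [Real.log_div (by positivity) (by positivity)] at h
    have h1 : m * (Real.log (m + 1) - Real.log m) ≤ 1 := by
      calc m * (Real.log (m + 1) - Real.log m) ≤ m * (((m : ℝ) + 1) / m - 1) := by gcongr
        _ = 1 := by field_simp; ring
    push_cast
    nlinarith

lemma log_factorial_le {m : ℕ} (hm : 1 ≤ m) :
    Real.log (m.factorial : ℝ) ≤ m * Real.log m - m + Real.log m + 1 := by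
  induction m, hm using Nat.le_induction with
  | base => simp
  | succ m hm ih =>
    rw [Nat.factorial_succ, Nat.cast_mul, Real.log_mul (by positivity) (by positivity)]
    have hm0 : (0 : ℝ) < m := by exact_mod_cast hm
    have h := Real.log_le_sub_one_of_pos (x := m / ((m : ℝ) + 1)) (by positivity)
    rw [Real.log_div (by positivity) (by positivity)] at h
    have h1 : ((m : ℝ) + 1) * (Real.log m - Real.log (m + 1)) ≤ -1 := by
      calc ((m : ℝ) + 1) * (Real.log m - Real.log (m + 1)) ≤ (m + 1) * (m / ((m : ℝ) + 1) - 1) := by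
            gcongr
        _ = -1 := by field_simp; ring
    push_cast
    nlinarith

/-- A lower bound in Mertens' theorem. -/
lemma log_sub_one_le_sum_vonMangoldt_div {m : ℕ} (hm : 1 ≤ m) :
    Real.log m - 1 ≤ ∑ d ∈ Finset.Ioc 0 m, vonMangoldt d / d := by
  have hm0 : (0 : ℝ) < m := by exact_mod_cast hm
  have h := le_log_factorial m
  rw [log_factorial_eq_sum_vonMangoldt] at h
  have h2 : ∑ d ∈ Finset.Ioc 0 m, vonMangoldt d * ((m / d : ℕ) : ℝ) ≤
      m * ∑ d ∈ Finset.Ioc 0 m, vonMangoldt d / d := by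
    rw [Finset.mul_sum]
    refine Finset.sum_le_sum fun d _ ↦ ?_
    have := Nat.cast_div_le (α := ℝ) (m := m) (n := d)
    calc vonMangoldt d * ((m / d : ℕ) : ℝ) ≤ vonMangoldt d * (m / d) := by
          gcongr
      _ = _ := by ring
  have h3 : m * (Real.log m - 1) ≤ m * ∑ d ∈ Finset.Ioc 0 m, vonMangoldt d / d := by linarith
  exact le_of_mul_le_mul_left h3 hm0

/-- The weights `1 - d / N` average Mertens' sums, so that the lower bound for these costs only
the constant `1` beyond the constant `1` intrinsic to the weights. -/
lemma le_sum_vonMangoldt_div_mul {N : ℕ} (hN : 1 ≤ N) :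
    Real.log N - 2 - Real.log N / N ≤
      ∑ d ∈ Finset.Ioc 0 N, vonMangoldt d / d * (1 - d / N) := by
  have hN0 : (0 : ℝ) < N := by exact_mod_cast hN
  -- `m - d` counts the `j` with `d ≤ j ≤ m - 1`.
  have key : ∀ m : ℕ, (∑ d ∈ Finset.Ioc 0 m, vonMangoldt d / d * (m - d : ℝ)) =
      ∑ j ∈ Finset.Ioc 0 (m - 1), ∑ d ∈ Finset.Ioc 0 j, vonMangoldt d / d := by
    intro m
    induction m with
    | zero => simp
    | succ m ih =>
      rw [Finset.sum_Ioc_succ_top (Nat.zero_le m), sub_self, mul_zero, add_zero]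
      have h1 : ∑ d ∈ Finset.Ioc 0 m, vonMangoldt d / d * (((m + 1 : ℕ) : ℝ) - d) =
          (∑ d ∈ Finset.Ioc 0 m, vonMangoldt d / d * (m - d : ℝ)) +
            ∑ d ∈ Finset.Ioc 0 m, vonMangoldt d / d := by
        rw [← Finset.sum_add_distrib]
        refine Finset.sum_congr rfl fun d _ ↦ ?_
        push_cast
        ring
      rw [h1, ih, Nat.add_sub_cancel]
      rcases Nat.eq_zero_or_pos m with rfl | hm
      · simp
      obtain ⟨k, rfl⟩ : ∃ k, m = k + 1 := ⟨m - 1, by omega⟩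
      rw [Nat.add_sub_cancel, Finset.sum_Ioc_succ_top (Nat.zero_le k)
        (fun j ↦ ∑ d ∈ Finset.Ioc 0 j, vonMangoldt d / (d : ℝ))]
  have hsum : ∀ m : ℕ, Real.log (m.factorial : ℝ) - m ≤
      ∑ j ∈ Finset.Ioc 0 m, ∑ d ∈ Finset.Ioc 0 j, vonMangoldt d / d := by
    intro m
    induction m with
    | zero => simp
    | succ m ih =>
      rw [Finset.sum_Ioc_succ_top (Nat.zero_le m), Nat.factorial_succ, Nat.cast_mul,
        Real.log_mul (by positivity) (by positivity)]
      have := log_sub_one_le_sum_vonMangoldt_div (m := m + 1) (by omega)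
      push_cast at *
      linarith
  have h1 : ∑ d ∈ Finset.Ioc 0 N, vonMangoldt d / d * (1 - d / N) =
      (∑ d ∈ Finset.Ioc 0 N, vonMangoldt d / d * (N - d : ℝ)) / N := by
    rw [Finset.sum_div]
    refine Finset.sum_congr rfl fun d _ ↦ ?_
    field_simp
  obtain ⟨k, rfl⟩ : ∃ k, N = k + 1 := ⟨N - 1, by omega⟩
  have h2 := hsum k
  have h3 := le_log_factorial (k + 1)
  rw [Nat.factorial_succ, Nat.cast_mul, Real.log_mul (by positivity) (by positivity)] at h3
  rw [h1, key, Nat.add_sub_cancel, le_div_iff₀ hN0]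
  have h4 : (Real.log ((k + 1 : ℕ) : ℝ) - 2 - Real.log ((k + 1 : ℕ) : ℝ) / ((k + 1 : ℕ) : ℝ)) *
      ((k + 1 : ℕ) : ℝ) = ((k + 1 : ℕ) : ℝ) * Real.log ((k + 1 : ℕ) : ℝ) - 2 * ((k + 1 : ℕ) : ℝ) -
        Real.log ((k + 1 : ℕ) : ℝ) := by
    field_simp
  rw [h4]
  push_cast at *
  linarith

lemma mul_log_sub_le_mul_log_sub {x y : ℝ} (hx : 1 ≤ x) (hxy : x ≤ y) :
    x * Real.log x - x ≤ y * Real.log y - y := by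
  have hx0 : 0 < x := by linarith
  have hy0 : 0 < y := by linarith
  have h := Real.log_le_sub_one_of_pos (x := x / y) (by positivity)
  rw [Real.log_div hx0.ne' hy0.ne'] at h
  have h1 : y * (Real.log x - Real.log y) ≤ x - y := by
    calc y * (Real.log x - Real.log y) ≤ y * (x / y - 1) := by gcongr
      _ = x - y := by field_simp
  nlinarith [Real.log_nonneg hx]

/-- A weak form of Stirling's formula at the integer part of `n / k`. -/
lemma abs_log_factorial_div_sub_le {n k : ℕ} (hk : 1 ≤ k) (hkn : k ≤ n) :
    |Real.log ((n / k).factorial : ℝ) - (n / k * Real.log (n / k) - n / k : ℝ)| ≤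
      Real.log n + 2 := by
  have hk0 : (1 : ℝ) ≤ k := by exact_mod_cast hk
  have hn1 : (k : ℝ) ≤ n := by exact_mod_cast hkn
  set x : ℝ := n / k with hx
  set m := n / k with hm
  have hx1 : 1 ≤ x := by rw [hx, one_le_div (by linarith)]; exact hn1
  have hxn : x ≤ n := div_le_self (by linarith) hk0
  have hm1 : 1 ≤ m := (Nat.one_le_div_iff (by omega)).2 hkn
  have hm1' : (1 : ℝ) ≤ m := by exact_mod_cast hm1
  have hmx : (m : ℝ) ≤ x := Nat.cast_div_le
  have hxm : x ≤ m + 1 := by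
    rw [hx, div_le_iff₀ (by linarith)]
    have := Nat.lt_mul_div_succ n (by omega : 0 < k)
    have h2 : n ≤ (m + 1) * k := by rw [mul_comm]; exact this.le
    exact_mod_cast h2
  have hlogm : Real.log m ≤ Real.log n := Real.log_le_log (by linarith) (by linarith)
  have hlogm0 := Real.log_nonneg hm1'
  have hup := log_factorial_le hm1
  have hlow := le_log_factorial (m + 1)
  rw [Nat.factorial_succ, Nat.cast_mul, Real.log_mul (by positivity) (by positivity)] at hlow
  have hmono1 := mul_log_sub_le_mul_log_sub hm1' hmx
  have hmono2 := mul_log_sub_le_mul_log_sub hx1 hxm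
  have hlog1 : Real.log (m + 1) ≤ Real.log m + 1 := by
    have h := Real.log_le_sub_one_of_pos (x := (m + 1) / m) (by positivity)
    rw [Real.log_div (by positivity) (by positivity)] at h
    have h3 : ((m : ℝ) + 1) / m - 1 = 1 / m := by field_simp; ring
    have h4 : (1 : ℝ) / m ≤ 1 := by rw [div_le_one (by linarith)]; exact hm1'
    linarith
  push_cast at hlow
  rw [abs_le]
  constructor <;> linarith

/-- Chebyshev's combination `⌊u⌋ - ⌊u/2⌋ - ⌊u/3⌋ - ⌊u/5⌋ + ⌊u/30⌋` is nonnegative, and at least `1`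
for `1 ≤ u < 6`; hence the bound for the sum of `Λ` over `(n/6, n]`. -/
lemma psi_sub_psi_div_six_le (n : ℕ) :
    (∑ d ∈ Finset.Ioc 0 n, vonMangoldt d) - ∑ d ∈ Finset.Ioc 0 (n / 6), vonMangoldt d ≤
      Real.log (n.factorial : ℝ) - Real.log ((n / 2).factorial : ℝ) -
        Real.log ((n / 3).factorial : ℝ) - Real.log ((n / 5).factorial : ℝ) +
        Real.log ((n / 30).factorial : ℝ) := by
  have hT : ∀ k : ℕ, Real.log ((n / k).factorial : ℝ) =
      ∑ d ∈ Finset.Ioc 0 n, vonMangoldt d * ((n / d / k : ℕ) : ℝ) := by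
    intro k
    rw [log_factorial_eq_sum_vonMangoldt]
    refine Finset.sum_subset_zero_on_sdiff
      (Finset.Ioc_subset_Ioc_right (Nat.div_le_self n k)) (fun d hd ↦ ?_) (fun d _ ↦ ?_)
    · rw [Finset.mem_sdiff, Finset.mem_Ioc, Finset.mem_Ioc] at hd
      have h1 : n / k < d := by omega
      rw [Nat.div_right_comm, Nat.div_eq_of_lt h1]
      simp
    · rw [Nat.div_right_comm]
  have h6 : ∑ d ∈ Finset.Ioc 0 (n / 6), vonMangoldt d =
      ∑ d ∈ Finset.Ioc 0 n, if d ≤ n / 6 then vonMangoldt d else 0 := by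
    rw [← Finset.sum_filter]
    refine Finset.sum_congr ?_ fun _ _ ↦ rfl
    ext d
    simp only [Finset.mem_Ioc, Finset.mem_filter]
    have := Nat.div_le_self n 6
    omega
  have hT1 : Real.log (n.factorial : ℝ) =
      ∑ d ∈ Finset.Ioc 0 n, vonMangoldt d * ((n / d : ℕ) : ℝ) := log_factorial_eq_sum_vonMangoldt n
  rw [hT1, hT 2, hT 3, hT 5, hT 30, h6, ← Finset.sum_sub_distrib, ← Finset.sum_sub_distrib,
    ← Finset.sum_sub_distrib, ← Finset.sum_sub_distrib, ← Finset.sum_add_distrib]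
  refine Finset.sum_le_sum fun d hd ↦ ?_
  rw [Finset.mem_Ioc] at hd
  have hΛ : 0 ≤ vonMangoldt d := vonMangoldt_nonneg
  have hq1 : 1 ≤ n / d := (Nat.one_le_div_iff hd.1).2 hd.2
  set q := n / d with hq
  have hcomb : q / 2 + q / 3 + q / 5 ≤ q + q / 30 := by omega
  have hcomb' : ((q / 2 : ℕ) : ℝ) + ((q / 3 : ℕ) : ℝ) + ((q / 5 : ℕ) : ℝ) ≤
      q + ((q / 30 : ℕ) : ℝ) := by exact_mod_cast hcomb
  by_cases h : d ≤ n / 6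
  · rw [if_pos h, sub_self]
    nlinarith
  · have hq6 : q < 6 := by
      rw [hq, Nat.div_lt_iff_lt_mul hd.1]
      omega
    have hcomb1 : q / 2 + q / 3 + q / 5 + 1 ≤ q + q / 30 := by omega
    have hcomb1' : ((q / 2 : ℕ) : ℝ) + ((q / 3 : ℕ) : ℝ) + ((q / 5 : ℕ) : ℝ) + 1 ≤
      q + ((q / 30 : ℕ) : ℝ) := by exact_mod_cast hcomb1
    rw [if_neg h, sub_zero]
    nlinarith

/-- The constant is `log 2 / 2 + log 3 / 3 + log 5 / 5 - log 30 / 30 = 0.92129…`. -/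
lemma psi_sub_psi_div_six_le_mul {n : ℕ} (hn : 30 ≤ n) :
    (∑ d ∈ Finset.Ioc 0 n, vonMangoldt d) - ∑ d ∈ Finset.Ioc 0 (n / 6), vonMangoldt d ≤
      0.9215 * n + 5 * (Real.log n + 2) := by
  have hn0 : (0 : ℝ) < n := by exact_mod_cast (by omega : 0 < n)
  have h := psi_sub_psi_div_six_le n
  have h1 := abs_le.1 (abs_log_factorial_div_sub_le (n := n) (k := 1) le_rfl (by omega))
  have h2 := abs_le.1 (abs_log_factorial_div_sub_le (n := n) (k := 2) (by norm_num) (by omega))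
  have h3 := abs_le.1 (abs_log_factorial_div_sub_le (n := n) (k := 3) (by norm_num) (by omega))
  have h5 := abs_le.1 (abs_log_factorial_div_sub_le (n := n) (k := 5) (by norm_num) (by omega))
  have h30 := abs_le.1 (abs_log_factorial_div_sub_le (n := n) (k := 30) (by norm_num) (by omega))
  have hl30 : Real.log 30 = Real.log 2 + Real.log 3 + Real.log 5 := by
    rw [← Real.log_mul (by norm_num) (by norm_num), ← Real.log_mul (by norm_num) (by norm_num)]
    norm_num
  push_cast at h1 h2 h3 h5 h30
  rw [Nat.div_one, div_one] at h1
  rw [Real.log_div hn0.ne' (by norm_num)] at h2 h3 h5 h30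
  rw [hl30] at h30
  have hA : (Real.log 2 / 2 + Real.log 3 / 3 + Real.log 5 / 5 -
      (Real.log 2 + Real.log 3 + Real.log 5) / 30) ≤ 0.9215 := by
    linarith [Real.log_two_lt_d9, Real.log_three_lt_d9, Real.log_five_lt_d9]
  have hA' := mul_le_mul_of_nonneg_left hA hn0.le
  have e : (n * Real.log n - n : ℝ) - (n / 2 * (Real.log n - Real.log 2) - n / 2) -
      (n / 3 * (Real.log n - Real.log 3) - n / 3) - (n / 5 * (Real.log n - Real.log 5) - n / 5) +
      (n / 30 * (Real.log n - (Real.log 2 + Real.log 3 + Real.log 5)) - n / 30) =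
      n * (Real.log 2 / 2 + Real.log 3 / 3 + Real.log 5 / 5 -
      (Real.log 2 + Real.log 3 + Real.log 5) / 30) := by ring
  linarith

/-- Chebyshev's upper bound for `ψ`, by iterating the bound over `(n/6, n]`: the constant `1.11`
exceeds `6 / 5 * 0.9215`. -/
lemma exists_psi_le : ∃ K : ℝ, 0 ≤ K ∧ ∀ n : ℕ,
    ∑ d ∈ Finset.Ioc 0 n, vonMangoldt d ≤ 1.11 * n + K := by
  have hlim : ∀ᶠ x : ℝ in atTop, 5 * (Real.log x + 2) ≤ 0.0035 * x := by
    have h1 : ∀ᶠ x : ℝ in atTop, ‖Real.log x‖ ≤ 0.0001 * ‖x‖ :=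
      Real.isLittleO_log_id_atTop.def (by norm_num)
    filter_upwards [h1, eventually_ge_atTop 4000] with x hx hx2
    rw [Real.norm_eq_abs, Real.norm_eq_abs, abs_of_pos (by linarith : 0 < x)] at hx
    linarith [le_abs_self (Real.log x)]
  obtain ⟨x₀, hx₀⟩ := eventually_atTop.1 hlim
  set n₀ := max 30 ⌈x₀⌉₊ with hn₀
  refine ⟨∑ d ∈ Finset.Ioc 0 n₀, vonMangoldt d, Finset.sum_nonneg fun _ _ ↦ vonMangoldt_nonneg,
    fun n ↦ ?_⟩
  induction n using Nat.strong_induction_on with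
  | _ n ih =>
    rcases le_total n n₀ with h | h
    · have h1 : ∑ d ∈ Finset.Ioc 0 n, vonMangoldt d ≤ ∑ d ∈ Finset.Ioc 0 n₀, vonMangoldt d :=
        Finset.sum_le_sum_of_subset_of_nonneg (Finset.Ioc_subset_Ioc_right h)
          fun _ _ _ ↦ vonMangoldt_nonneg
      have : (0 : ℝ) ≤ n := Nat.cast_nonneg n
      linarith
    · have hn30 : 30 ≤ n := (le_max_left _ _).trans h
      have hnx : x₀ ≤ n := (Nat.le_ceil x₀).trans (by exact_mod_cast (le_max_right _ _).trans h)
      have h1 := psi_sub_psi_div_six_le_mul hn30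
      have h2 := ih (n / 6) (by omega)
      have h3 := hx₀ n hnx
      have h4 : ((n / 6 : ℕ) : ℝ) ≤ n / 6 := Nat.cast_div_le
      linarith

/-! ### The size of the resonator -/

/-- Abel summation against an antitone weight. -/
lemma sum_mul_le_of_antitoneOn {c h : ℕ → ℝ} {a K : ℝ} {N : ℕ}
    (hc : ∀ m, ∑ n ∈ Finset.Ioc 0 m, c n ≤ a * m + K)
    (hanti : ∀ n, 1 ≤ n → n < N → h (n + 1) ≤ h n) (hN : 1 ≤ N) (h0 : 0 ≤ h N) :
    ∑ n ∈ Finset.Ioc 0 N, c n * h n ≤ a * ∑ n ∈ Finset.Ioc 0 N, h n + K * h 1 := by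
  -- The last term, absent from the claim, makes the induction on `m` go through.
  have key : ∀ m : ℕ, 1 ≤ m → m ≤ N → ∑ n ∈ Finset.Ioc 0 m, c n * h n ≤
      a * ∑ n ∈ Finset.Ioc 0 m, h n + K * h 1 -
        (a * m + K - ∑ n ∈ Finset.Ioc 0 m, c n) * h m := by
    intro m hm
    induction m, hm using Nat.le_induction with
    | base =>
      intro _
      simp
      linarith
    | succ m hm ih =>
      intro hmN
      have h1 := ih (by omega)
      have h2 := mul_nonneg (sub_nonneg.2 (hc m)) (sub_nonneg.2 (hanti m hm (by omega)))
      rw [Finset.sum_Ioc_succ_top (Nat.zero_le m), Finset.sum_Ioc_succ_top (Nat.zero_le m),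
        Finset.sum_Ioc_succ_top (Nat.zero_le m)]
      push_cast
      linarith
  have h1 := key N hN le_rfl
  have h2 := mul_nonneg (sub_nonneg.2 (hc N)) h0
  linarith

/-- The sum is the logarithm of the binomial coefficient `(2 N - 1).choose N`. -/
lemma sum_log_two_mul_div_sub_one_le {N : ℕ} (hN : 1 ≤ N) :
    ∑ n ∈ Finset.Ioc 0 N, Real.log (2 * N / n - 1) ≤ N * Real.log 4 := by
  have h1 : ∀ n ∈ Finset.Ioc 0 N, Real.log (2 * N / n - 1 : ℝ) =
      Real.log ((2 * N - n : ℕ) : ℝ) - Real.log n := by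
    intro n hn
    rw [Finset.mem_Ioc] at hn
    have hn0 : (0 : ℝ) < n := by exact_mod_cast hn.1
    have hn1 : (0 : ℝ) < (2 * N - n : ℕ) := by exact_mod_cast (by omega : 0 < 2 * N - n)
    rw [← Real.log_div hn1.ne' hn0.ne', Nat.cast_sub (by omega)]
    congr 1
    push_cast
    field_simp
  rw [Finset.sum_congr rfl h1, Finset.sum_sub_distrib]
  have h2 : ∑ n ∈ Finset.Ioc 0 N, Real.log ((2 * N - n : ℕ) : ℝ) =
      Real.log (((2 * N - 1).descFactorial N : ℕ) : ℝ) := by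
    have hr : ∀ (f : ℕ → ℝ) (m : ℕ), ∑ n ∈ Finset.Ioc 0 m, f n = ∑ i ∈ Finset.range m, f (i + 1) :=
      fun f m ↦ by
        induction m with
        | zero => simp
        | succ m ih => rw [Finset.sum_Ioc_succ_top (Nat.zero_le m), ih, Finset.sum_range_succ]
    rw [Nat.descFactorial_eq_prod_range, Nat.cast_prod, Real.log_prod, hr]
    · refine Finset.sum_congr rfl fun i _ ↦ ?_
      rw [add_comm i 1, ← Nat.sub_sub]
    · intro i hi
      rw [Finset.mem_range] at hi
      exact_mod_cast (by omega : 2 * N - 1 - i ≠ 0)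
  have h3 : ∑ n ∈ Finset.Ioc 0 N, Real.log (n : ℝ) = Real.log (N.factorial : ℝ) := by
    clear h1 h2 hN
    induction N with
    | zero => simp
    | succ m ih =>
      rw [Finset.sum_Ioc_succ_top (Nat.zero_le m), ih, Nat.factorial_succ, Nat.cast_mul,
        Real.log_mul (by positivity) (by positivity), add_comm]
  have hch : (0 : ℝ) < ((2 * N - 1).choose N : ℕ) := by
    exact_mod_cast Nat.choose_pos (by omega)
  rw [h2, h3, Nat.descFactorial_eq_factorial_mul_choose, Nat.cast_mul,
    Real.log_mul (by positivity) hch.ne', add_sub_cancel_left, ← Real.log_pow]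
  refine Real.log_le_log hch ?_
  have h4 : (2 * N - 1).choose N ≤ 4 ^ N := by
    calc (2 * N - 1).choose N ≤ 2 ^ (2 * N - 1) := Nat.choose_le_two_pow _ _
      _ ≤ 2 ^ (2 * N) := Nat.pow_le_pow_right (by norm_num) (by omega)
      _ = 4 ^ N := by rw [pow_mul]; norm_num
  exact_mod_cast h4

/-- The logarithm of the ratio of the maximum of the resonance weight to its mean. -/
noncomputable def logRatio (N : ℕ) : ℝ := ∑ p ∈ N.primesLE, Real.log (2 * N / p - 1)

lemma weight_zero_eq (N : ℕ) : weight N 0 = Real.exp (logRatio N) * meanWeight N := by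
  have h1 : ∀ p ∈ N.primesLE, (0 : ℝ) < p ∧ (p : ℝ) ≤ N := fun p hp ↦ by
    rw [Nat.mem_primesLE] at hp
    exact ⟨by exact_mod_cast hp.2.pos, by exact_mod_cast hp.1⟩
  rw [logRatio, Real.exp_sum, meanWeight, ← Finset.prod_mul_distrib, weight, resonator, norm_prod,
    ← Finset.prod_pow]
  refine Finset.prod_congr rfl fun p hp ↦ ?_
  obtain ⟨hp0, hpN⟩ := h1 p hp
  have hN0 : (0 : ℝ) < N := hp0.trans_le hpN
  have h2 : (0 : ℝ) < 2 * N / p - 1 := by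
    rw [sub_pos, one_lt_div hp0]; linarith
  have h3 : (1 - (1 - (p : ℝ) / N) ^ 2) ≠ 0 :=
    (one_sub_sq_pos (coeff_mem hp).1 (coeff_mem hp).2).ne'
  have h4 : (1 - (1 - (p : ℝ) / N) ^ 2) = p / N * (2 - p / N) := by ring
  have h5 : (0 : ℝ) < 2 - p / N := by
    have : (p : ℝ) / N ≤ 1 := (div_le_one hN0).2 hpN
    linarith
  rw [Real.exp_log h2, eulerFactor_at_zero, Complex.norm_real, Real.norm_eq_abs, sq_abs,
    sub_sub_cancel, h4]
  have h6 : (2 * N / p - 1 : ℝ) = (2 - p / N) * (N / p) := by field_simp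
  rw [h6]
  generalize (2 - (p : ℝ) / N) = a at *
  field_simp

lemma exists_sum_vonMangoldt_mul_log_le : ∃ K : ℝ, 0 ≤ K ∧ ∀ N : ℕ, 1 ≤ N →
    ∑ n ∈ Finset.Ioc 0 N, vonMangoldt n * Real.log (2 * N / n - 1) ≤
      1.11 * Real.log 4 * N + K * Real.log (2 * N) := by
  obtain ⟨K, hK, hpsi⟩ := exists_psi_le
  refine ⟨K, hK, fun N hN ↦ ?_⟩
  have hN0 : (1 : ℝ) ≤ N := by exact_mod_cast hN
  have h := sum_mul_le_of_antitoneOn (h := fun n : ℕ ↦ Real.log (2 * N / n - 1)) hpsi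
    (fun n hn hnN ↦ ?_) hN ?_
  · have h2 := sum_log_two_mul_div_sub_one_le hN
    have h3 : Real.log (2 * N / (1 : ℕ) - 1) ≤ Real.log (2 * N) := by
      refine Real.log_le_log ?_ ?_ <;> · push_cast; linarith
    have h4 := mul_le_mul_of_nonneg_left h3 hK
    linarith
  · have h5 : (n : ℝ) + 1 ≤ N := by exact_mod_cast hnN
    have h6 : (1 : ℝ) ≤ n := by exact_mod_cast hn
    have h7 : (1 : ℝ) < 2 * N / (n + 1 : ℕ) := by
      rw [one_lt_div (by positivity)]; push_cast; linarith
    refine Real.log_le_log (by linarith) ?_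
    gcongr
    linarith
  · refine Real.log_nonneg ?_
    have : (2 * N / N : ℝ) = 2 := by field_simp
    linarith

/-- The primes up to `Y` are counted trivially; for the others `1 ≤ log p / log Y`. -/
lemma logRatio_le {N : ℕ} (hN : 1 ≤ N) {Y : ℝ} (hY : 1 < Y) :
    logRatio N ≤ Y * Real.log (2 * N) +
      (∑ n ∈ Finset.Ioc 0 N, vonMangoldt n * Real.log (2 * N / n - 1)) / Real.log Y := by
  have hN0 : (1 : ℝ) ≤ N := by exact_mod_cast hN
  have hlY : 0 < Real.log Y := Real.log_pos hY
  have hpos : ∀ n ∈ Finset.Ioc 0 N, 0 ≤ Real.log (2 * N / n - 1 : ℝ) := fun n hn ↦ by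
    rw [Finset.mem_Ioc] at hn
    have hn0 : (0 : ℝ) < n := by exact_mod_cast hn.1
    have hnN : (n : ℝ) ≤ N := by exact_mod_cast hn.2
    refine Real.log_nonneg ?_
    have : (2 : ℝ) ≤ 2 * N / n := by rw [le_div_iff₀ hn0]; linarith
    linarith
  have hsub : N.primesLE ⊆ Finset.Ioc 0 N := fun p hp ↦ by
    rw [Nat.mem_primesLE] at hp
    exact Finset.mem_Ioc.2 ⟨hp.2.pos, hp.1⟩
  have hterm : ∀ p ∈ N.primesLE, Real.log (2 * N / p - 1 : ℝ) ≤
      (if p ∈ Finset.Ioc 0 ⌊Y⌋₊ then Real.log (2 * N) else 0) +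
        vonMangoldt p * Real.log (2 * N / p - 1) / Real.log Y := by
    intro p hp
    have hpos' := hpos p (hsub hp)
    have hp' := (Nat.mem_primesLE.1 hp).2
    have hpN : (p : ℝ) ≤ N := by exact_mod_cast (Nat.mem_primesLE.1 hp).1
    have hp1 : (1 : ℝ) ≤ p := by exact_mod_cast hp'.one_lt.le
    split_ifs with h
    · have h1 : Real.log (2 * N / p - 1 : ℝ) ≤ Real.log (2 * N) := by
        have h2 : (2 * N / p : ℝ) ≤ 2 * N := div_le_self (by linarith) hp1
        have h3 : (2 : ℝ) ≤ 2 * N / p := by rw [le_div_iff₀ (by linarith)]; linarith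
        exact Real.log_le_log (by linarith) (by linarith)
      have h4 : 0 ≤ vonMangoldt p * Real.log (2 * N / p - 1) / Real.log Y :=
        div_nonneg (mul_nonneg vonMangoldt_nonneg hpos') hlY.le
      linarith
    · have h1 : Y ≤ p := by
        by_contra h2
        exact h (Finset.mem_Ioc.2 ⟨hp'.pos, Nat.le_floor (not_le.1 h2).le⟩)
      have h2 : Real.log Y ≤ Real.log p := Real.log_le_log (by linarith) h1
      rw [zero_add, vonMangoldt_apply_prime hp', le_div_iff₀ hlY, mul_comm]
      gcongr
  refine (Finset.sum_le_sum hterm).trans ?_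
  rw [Finset.sum_add_distrib, Finset.sum_div]
  refine add_le_add ?_ ?_
  · rw [← Finset.sum_filter, Finset.sum_const, nsmul_eq_mul]
    have h1 : ((N.primesLE.filter (· ∈ Finset.Ioc 0 ⌊Y⌋₊)).card : ℝ) ≤ Y := by
      have h2 : (N.primesLE.filter (· ∈ Finset.Ioc 0 ⌊Y⌋₊)).card ≤ ⌊Y⌋₊ := by
        refine (Finset.card_le_card (t := Finset.Ioc 0 ⌊Y⌋₊) fun p hp ↦ ?_).trans (by simp)
        exact (Finset.mem_filter.1 hp).2
      exact (Nat.cast_le.2 h2).trans (Nat.floor_le (by linarith))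
    have h3 : 0 ≤ Real.log (2 * N) := Real.log_nonneg (by linarith)
    gcongr
  · exact Finset.sum_le_sum_of_subset_of_nonneg hsub fun n hn _ ↦
      div_nonneg (mul_nonneg vonMangoldt_nonneg (hpos n hn)) hlY.le

/-- The ratio of the maximum of the resonance weight to its mean, up to Chebyshev's constant. -/
lemma eventually_logRatio_le : ∀ᶠ N : ℕ in atTop,
    logRatio N ≤ 1.111 * Real.log 4 * (N / Real.log N) := by
  obtain ⟨K, hK, hsum⟩ := exists_sum_vonMangoldt_mul_log_le
  have hl4 : 1 < Real.log 4 := by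
    rw [Real.lt_log_iff_exp_lt (by norm_num)]
    linarith [Real.exp_one_lt_d9]
  have hev : ∀ᶠ x : ℝ in atTop, x ^ (0.9995 : ℝ) * Real.log (2 * x) * Real.log x +
      K * Real.log (2 * x) / 0.9995 ≤ 0.0001 * x := by
    have hlog : ∀ᶠ x : ℝ in atTop, ‖Real.log x‖ ≤ 1 * ‖x ^ (0.0001 : ℝ)‖ :=
      (isLittleO_log_rpow_atTop (by norm_num : (0 : ℝ) < 0.0001)).def one_pos
    have hlim : Tendsto (fun x : ℝ ↦ x ^ (-(0.0003 : ℝ))) atTop (𝓝 0) :=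
      tendsto_rpow_neg_atTop (by norm_num)
    have hsmall := hlim.eventually_le_const (u := 0.0001 / (2 + 4 * K)) (by positivity)
    filter_upwards [hlog, hsmall, eventually_ge_atTop 2] with x h1 h2 hx
    have hx0 : 0 < x := by linarith
    have hlx : 0 < Real.log x := Real.log_pos (by linarith)
    rw [Real.norm_eq_abs, Real.norm_eq_abs, abs_of_pos hlx, one_mul,
      abs_of_nonneg (Real.rpow_nonneg hx0.le _)] at h1
    set y := x ^ (0.0001 : ℝ) with hy
    have hy1 : 1 ≤ y := Real.one_le_rpow (by linarith) (by norm_num)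
    have h2x : Real.log (2 * x) ≤ 2 * y := by
      rw [Real.log_mul (by norm_num) hx0.ne']
      have : Real.log 2 ≤ Real.log x := Real.log_le_log (by norm_num) hx
      linarith
    have e1 : x ^ (0.9995 : ℝ) * y * y = x * x ^ (-(0.0003 : ℝ)) := by
      rw [hy, ← Real.rpow_add hx0, ← Real.rpow_add hx0]
      nth_rw 2 [← Real.rpow_one x]
      rw [← Real.rpow_add hx0]
      norm_num
    have e2 : y ≤ x * x ^ (-(0.0003 : ℝ)) := by
      nth_rw 1 [← Real.rpow_one x]
      rw [hy, ← Real.rpow_add hx0]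
      exact Real.rpow_le_rpow_of_exponent_le (by linarith) (by norm_num)
    have h3 : x ^ (0.9995 : ℝ) * Real.log (2 * x) * Real.log x ≤ 2 * (x * x ^ (-(0.0003 : ℝ))) := by
      calc _ ≤ x ^ (0.9995 : ℝ) * (2 * y) * y := by gcongr
        _ = 2 * (x ^ (0.9995 : ℝ) * y * y) := by ring
        _ = _ := by rw [e1]
    have h4 : K * Real.log (2 * x) / 0.9995 ≤ 4 * K * (x * x ^ (-(0.0003 : ℝ))) := by
      rw [div_le_iff₀ (by norm_num)]
      have : K * Real.log (2 * x) ≤ K * (2 * (x * x ^ (-(0.0003 : ℝ)))) := by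
        gcongr; linarith
      have h5 : 0 ≤ K * (x * x ^ (-(0.0003 : ℝ))) := by positivity
      linarith
    have h6 : x * ((2 + 4 * K) * x ^ (-(0.0003 : ℝ))) ≤ x * 0.0001 := by
      rw [le_div_iff₀ (by positivity)] at h2
      gcongr
      linarith
    linarith
  filter_upwards [tendsto_natCast_atTop_atTop.eventually hev, eventually_ge_atTop 2] with N h hN
  have hN0 : (2 : ℝ) ≤ N := by exact_mod_cast hN
  have hlN : 0 < Real.log N := Real.log_pos (by linarith)
  have hY : 1 < (N : ℝ) ^ (0.9995 : ℝ) := Real.one_lt_rpow (by linarith) (by norm_num)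
  -- With `Y = N ^ 0.9995` the loss `1 / 0.9995` is absorbed by `1.111 / 1.11`.
  have h1 := logRatio_le (by omega : 1 ≤ N) hY
  have h2 := hsum N (by omega)
  rw [Real.log_rpow (by linarith)] at h1
  have h3 : (∑ n ∈ Finset.Ioc 0 N, vonMangoldt n * Real.log (2 * N / n - 1)) /
      (0.9995 * Real.log N) ≤ (1.11 * Real.log 4 * N + K * Real.log (2 * N)) /
      (0.9995 * Real.log N) := by gcongr
  have h4 := h1.trans (add_le_add le_rfl h3)
  rw [← mul_div_assoc, le_div_iff₀ hlN]
  refine (mul_le_mul_of_nonneg_right h4 hlN.le).trans ?_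
  have e : ((N : ℝ) ^ (0.9995 : ℝ) * Real.log (2 * N) + (1.11 * Real.log 4 * N +
      K * Real.log (2 * N)) / (0.9995 * Real.log N)) * Real.log N =
      ((N : ℝ) ^ (0.9995 : ℝ) * Real.log (2 * N) * Real.log N + K * Real.log (2 * N) / 0.9995) +
      1.11 / 0.9995 * (Real.log 4 * N) := by
    field_simp
    ring
  rw [e]
  have h5 : (N : ℝ) ≤ Real.log 4 * N := by nlinarith
  nlinarith

/-! ### The contribution of prime powers to the constant -/

/-- The double series in the constant `C₁` is at least its part over the primes `2, 3, 5`. -/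
lemma le_tsum_log_div_pow : Real.log 2 / 2 + Real.log 3 / 6 + Real.log 5 / 20 ≤
    ∑' k : ℕ, ∑' p : Nat.Primes, Real.log (p : ℕ) / ((p : ℕ) : ℝ) ^ (k + 2) := by
  have hlog0 : ∀ p : Nat.Primes, 0 ≤ Real.log (p : ℕ) := fun p ↦ Real.log_natCast_nonneg _
  have hp2 : ∀ p : Nat.Primes, (2 : ℝ) ≤ (p : ℕ) := fun p ↦ by exact_mod_cast p.2.two_le
  have hs0 : Summable fun p : Nat.Primes ↦ Real.log (p : ℕ) / ((p : ℕ) : ℝ) ^ 2 := by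
    have h1 : Summable fun n : ℕ ↦ 2 * (1 / (n : ℝ) ^ (3 / 2 : ℝ)) :=
      (Real.summable_one_div_nat_rpow.2 (by norm_num)).mul_left 2
    refine Summable.of_nonneg_of_le (fun p ↦ div_nonneg (hlog0 p) (by positivity)) (fun p ↦ ?_)
      (h1.comp_injective (i := fun p : Nat.Primes ↦ (p : ℕ)) Subtype.val_injective)
    have hp0 : (0 : ℝ) < (p : ℕ) := by linarith [hp2 p]
    have h2 := Real.log_le_rpow_div hp0.le (by norm_num : (0 : ℝ) < 1 / 2)
    have h3 : ((p : ℕ) : ℝ) ^ 2 = ((p : ℕ) : ℝ) ^ (3 / 2 : ℝ) * ((p : ℕ) : ℝ) ^ (1 / 2 : ℝ) := by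
      rw [← Real.rpow_add hp0]; norm_num
    simp only [Function.comp_apply]
    rw [h3, mul_one_div, div_le_div_iff₀ (by positivity) (by positivity)]
    have h4 : 0 ≤ ((p : ℕ) : ℝ) ^ (3 / 2 : ℝ) := by positivity
    nlinarith
  have hle : ∀ (k : ℕ) (p : Nat.Primes), Real.log (p : ℕ) / ((p : ℕ) : ℝ) ^ (k + 2) ≤
      (1 / 2) ^ k * (Real.log (p : ℕ) / ((p : ℕ) : ℝ) ^ 2) := by
    intro k p
    have hp0 : (0 : ℝ) < (p : ℕ) := by linarith [hp2 p]
    rw [pow_add, one_div_pow, one_div_mul_eq_div, div_div, mul_comm (((p : ℕ) : ℝ) ^ 2)]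
    have h2 := hp2 p
    have h3 := hlog0 p
    gcongr
  have hs : ∀ k : ℕ, Summable fun p : Nat.Primes ↦
      Real.log (p : ℕ) / ((p : ℕ) : ℝ) ^ (k + 2) := fun k ↦
    Summable.of_nonneg_of_le (fun p ↦ div_nonneg (hlog0 p) (by positivity)) (hle k)
      (hs0.mul_left _)
  have hout : Summable fun k : ℕ ↦ ∑' p : Nat.Primes,
      Real.log (p : ℕ) / ((p : ℕ) : ℝ) ^ (k + 2) := by
    refine Summable.of_nonneg_of_le
      (fun k ↦ tsum_nonneg fun p ↦ div_nonneg (hlog0 p) (by positivity)) (fun k ↦ ?_)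
      ((summable_geometric_of_lt_one (by norm_num) (by norm_num : (1 / 2 : ℝ) < 1)).mul_right
        (∑' p : Nat.Primes, Real.log (p : ℕ) / ((p : ℕ) : ℝ) ^ 2))
    rw [← tsum_mul_left]
    exact (hs k).tsum_le_tsum (hle k) (hs0.mul_left _)
  have hgeom : ∀ q : ℝ, 1 < q → HasSum (fun k : ℕ ↦ Real.log q / q ^ (k + 2))
      (Real.log q / (q * (q - 1))) := by
    intro q hq
    have h1 := (hasSum_geometric_of_lt_one (inv_nonneg.2 (by linarith)) (inv_lt_one_of_one_lt₀ hq)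
      ).mul_left (Real.log q / q ^ 2)
    have hq0 : q ≠ 0 := by positivity
    have hq1 : q - 1 ≠ 0 := by linarith
    have e : ∀ k : ℕ, Real.log q / q ^ (k + 2) = Real.log q / q ^ 2 * q⁻¹ ^ k := fun k ↦ by
      rw [pow_add, inv_pow]
      field_simp
    have e2 : Real.log q / q ^ 2 * (1 - q⁻¹)⁻¹ = Real.log q / (q * (q - 1)) := by
      have : 1 - q⁻¹ = (q - 1) / q := by field_simp
      rw [this]
      field_simp
    rw [e2] at h1
    exact h1.congr_fun e
  have hsum3 := ((hgeom 2 (by norm_num)).add (hgeom 3 (by norm_num))).add (hgeom 5 (by norm_num))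
  have h6 : Real.log 2 / 2 + Real.log 3 / 6 + Real.log 5 / 20 =
      Real.log 2 / (2 * (2 - 1)) + Real.log 3 / (3 * (3 - 1)) + Real.log 5 / (5 * (5 - 1)) := by
    norm_num
  rw [h6, ← hsum3.tsum_eq]
  refine hsum3.summable.tsum_le_tsum (fun k ↦ ?_) hout
  obtain ⟨p₂, h₂⟩ : ∃ p : Nat.Primes, (p : ℕ) = 2 := ⟨⟨2, Nat.prime_two⟩, rfl⟩
  obtain ⟨p₃, h₃⟩ : ∃ p : Nat.Primes, (p : ℕ) = 3 := ⟨⟨3, Nat.prime_three⟩, rfl⟩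
  obtain ⟨p₅, h₅⟩ : ∃ p : Nat.Primes, (p : ℕ) = 5 := ⟨⟨5, Nat.prime_five⟩, rfl⟩
  have h23 : p₂ ≠ p₃ := by rintro rfl; omega
  have h25 : p₂ ≠ p₅ := by rintro rfl; omega
  have h35 : p₃ ≠ p₅ := by rintro rfl; omega
  have h7 := (hs k).sum_le_tsum {p₂, p₃, p₅} fun p _ ↦ div_nonneg (hlog0 p) (by positivity)
  rw [Finset.sum_insert (by simp [h23, h25]), Finset.sum_insert (by simp [h35]),
    Finset.sum_singleton, ← add_assoc, h₂, h₃, h₅] at h7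
  exact_mod_cast h7

/-- Prime powers contribute more than is lost by using Chebyshev's bounds in place of the prime
number theorem. -/
lemma slack_pos : 0 < Real.eulerMascheroniConstant +
    (∑' k : ℕ, ∑' p : Nat.Primes, Real.log (p : ℕ) / ((p : ℕ) : ℝ) ^ (k + 2)) - 1 -
      Real.log 1.112 := by
  have h1 := Real.one_half_lt_eulerMascheroniConstant
  have h2 := le_tsum_log_div_pow
  have h3 : Real.log 1.112 < 0.1095 := by
    rw [Real.log_lt_iff_lt_exp (by norm_num)]
    have := Real.quadratic_le_exp_of_nonneg (x := 0.1095) (by norm_num)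
    norm_num at this ⊢
    linarith
  linarith [Real.log_two_gt_d9, Real.log_three_gt_d9, Real.log_five_gt_d9]

/-! ### From the resonance inequality to the measure of large values -/

/-- If the values of `-Re ζ'/ζ (1 + i t)` are at most `B`, the excess of the main term over a
threshold `V` bounds the measure of the `t ∈ [U, T]` where `V` is reached from below. The mean of
the weight has been divided out. -/
lemma resonance_measure (N : ℕ) {T U V B : ℝ} (hT : 0 < T) (hU : 0 ≤ U) (hV : 0 ≤ V)
    (hB : ∀ t ∈ Set.Ioc 0 T, |regularPart 0 t| ≤ B)
    (hS : V ≤ ∑ d ∈ Finset.Ioc 0 N, vonMangoldt d / d * (1 - d / N)) :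
    ((∑ d ∈ Finset.Ioc 0 N, vonMangoldt d / d * (1 - d / N)) - V) * (T / 2) ≤
      (Real.pi / 2 + B * (U + volume.real {t | t ∈ Set.Icc U T ∧ V ≤ regularPart 0 t})) *
        Real.exp (logRatio N) := by
  set S := ∑ d ∈ Finset.Ioc 0 N, vonMangoldt d / d * (1 - (d : ℝ) / N) with hSdef
  set A := {t | t ∈ Set.Icc U T ∧ V ≤ regularPart 0 t} with hA
  have hw := continuous_weight N
  have hR : Continuous (regularPart 0) :=
    Continuous.uncurry_left (f := regularPart) 0 continuous_regularPart
  have hB0 : 0 ≤ B := (abs_nonneg _).trans (hB T ⟨hT, le_rfl⟩)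
  have hG0 : 0 ≤ weight N 0 := weight_nonneg N 0
  have hAm : MeasurableSet A :=
    (isClosed_Icc.inter (isClosed_le continuous_const hR)).measurableSet
  have hAfin : volume A ≠ ⊤ :=
    ((measure_mono fun t ht ↦ ht.1).trans_lt (measure_Icc_lt_top (a := U) (b := T))).ne
  set E := Set.Ioc 0 U ∪ A with hE
  have hEm : MeasurableSet E := measurableSet_Ioc.union hAm
  have h1 := resonance_line N hT
  have h2 := mean_weight_le hT N
  set J := ∫ t in (0 : ℝ)..T, (1 - t / T) * weight N t with hJ
  have hint : ∀ f : ℝ → ℝ, Continuous f → IntegrableOn f (Set.Ioc 0 T) := fun f hf ↦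
    (hf.integrableOn_Icc).mono_set Set.Ioc_subset_Icc_self
  -- Off the large values and the initial segment the integrand is at most `V` times the weight.
  have h3 : ∫ t in (0 : ℝ)..T, (1 - t / T) * (regularPart 0 t * weight N t) ≤
      V * J + B * weight N 0 * (U + volume.real A) := by
    rw [hJ, ← intervalIntegral.integral_const_mul, intervalIntegral.integral_of_le hT.le,
      intervalIntegral.integral_of_le hT.le, ← sub_le_iff_le_add', ← integral_sub
        (hint _ (by fun_prop)) (hint _ (by fun_prop))]
    calc _ ≤ ∫ t in Set.Ioc 0 T, E.indicator (fun _ ↦ B * weight N 0) t := by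
          refine setIntegral_mono_on ((hint _ (by fun_prop)).sub (hint _ (by fun_prop))) ?_
            measurableSet_Ioc fun t ht ↦ ?_
          · exact (integrableOn_const (by simp)).indicator hEm
          have ht1 : 0 ≤ 1 - t / T := by
            rw [sub_nonneg, div_le_one hT]; exact ht.2
          have ht2 : 1 - t / T ≤ 1 := by
            have : 0 ≤ t / T := div_nonneg ht.1.le hT.le
            linarith
          have hwt := weight_nonneg N t
          by_cases htE : t ∈ E
          · rw [Set.indicator_of_mem htE]
            have h4 : (1 - t / T) * (regularPart 0 t * weight N t) ≤ B * weight N 0 := by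
              calc (1 - t / T) * (regularPart 0 t * weight N t)
                  ≤ (1 - t / T) * (B * weight N 0) := by
                    gcongr
                    · exact (le_abs_self _).trans (hB t ht)
                    · exact weight_le_weight_zero N t
                _ ≤ 1 * (B * weight N 0) := by gcongr
                _ = _ := one_mul _
            have h5 : 0 ≤ V * ((1 - t / T) * weight N t) := by positivity
            linarith
          · rw [Set.indicator_of_notMem htE]
            have h4 : regularPart 0 t ≤ V := by
              by_contra h
              refine htE ?_
              rcases le_total t U with h5 | h5
              · exact Or.inl ⟨ht.1, h5⟩
              · exact Or.inr ⟨⟨h5, ht.2⟩, (not_le.1 h).le⟩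
            have h5 : (1 - t / T) * (regularPart 0 t * weight N t) ≤
              (1 - t / T) * (V * weight N t) := by gcongr
            linarith
      _ = volume.real (Set.Ioc 0 T ∩ E) * (B * weight N 0) := by
          rw [setIntegral_indicator hEm, setIntegral_const, smul_eq_mul]
      _ ≤ (U + volume.real A) * (B * weight N 0) := by
          gcongr
          have hfin : volume E ≠ ⊤ := (measure_union_lt_top (by simp) hAfin.lt_top).ne
          calc volume.real (Set.Ioc 0 T ∩ E) ≤ volume.real E :=
                measureReal_mono Set.inter_subset_right hfin
            _ ≤ volume.real (Set.Ioc 0 U) + volume.real A := measureReal_union_le _ _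
            _ = U + volume.real A := by
                rw [Real.volume_real_Ioc_of_le hU, sub_zero]
      _ = _ := by ring
  have hm := meanWeight_pos N
  have h4 := mul_le_mul_of_nonneg_left h2 (sub_nonneg.2 hS)
  rw [weight_zero_eq] at h1 h3
  have h5 : meanWeight N * ((S - V) * (T / 2)) ≤ meanWeight N *
      ((Real.pi / 2 + B * (U + volume.real A)) * Real.exp (logRatio N)) := by
    linarith
  exact le_of_mul_le_mul_left h5 hm

/-- With `N` about `θ / (1.112 log 4) * log T * log (log T)`, the ratio of the maximum of the weight
to its mean is at most `T ^ θ`. The factor `1.112`, slightly larger than the constant in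
`eventually_logRatio_le`, replaces the `1` that the prime number theorem would give. -/
lemma eventually_exp_logRatio_le {θ : ℝ} (hθ : 0 < θ) : ∀ᶠ T : ℝ in atTop,
    Real.exp (logRatio ⌊θ / (1.112 * Real.log 4) * Real.log T * Real.log (Real.log T)⌋₊) ≤
      T ^ θ := by
  have hl4 : 0 < Real.log 4 := Real.log_pos (by norm_num)
  set κ := θ / (1.112 * Real.log 4) with hκ
  have hκ0 : 0 < κ := by positivity
  have hlog := Real.tendsto_log_atTop
  have hlog2 := hlog.comp hlog
  have hy : Tendsto (fun T : ℝ ↦ κ * Real.log T * Real.log (Real.log T)) atTop atTop :=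
    (hlog.const_mul_atTop hκ0).atTop_mul_atTop₀ hlog2
  have hN := (tendsto_nat_floor_atTop (α := ℝ)).comp hy
  filter_upwards [hN.eventually eventually_logRatio_le, hlog.eventually_gt_atTop 1,
    hlog2.eventually_ge_atTop (2 / κ), eventually_gt_atTop 0] with T h1 h2 h3 hT
  simp only [Function.comp_apply] at h1 h3
  set ℓ := Real.log T
  set ℓ₂ := Real.log ℓ
  have hℓ₂ : 0 < ℓ₂ := Real.log_pos h2
  set y := κ * ℓ * ℓ₂ with hy_def
  set N := ⌊y⌋₊
  have hy0 : 0 ≤ y := by positivity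
  have hNy : (N : ℝ) ≤ y := Nat.floor_le hy0
  have hyN : y < N + 1 := Nat.lt_floor_add_one y
  have h4 : 2 * ℓ ≤ y := by
    rw [div_le_iff₀ hκ0] at h3
    calc 2 * ℓ ≤ ℓ₂ * κ * ℓ := by gcongr
      _ = y := by rw [hy_def]; ring
  have h5 : ℓ ≤ N := by linarith
  have h6 : ℓ₂ ≤ Real.log N := Real.log_le_log (by linarith) h5
  have h7 : (N : ℝ) / Real.log N ≤ κ * ℓ := by
    rw [div_le_iff₀ (by linarith)]
    calc (N : ℝ) ≤ κ * ℓ * ℓ₂ := hNy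
      _ ≤ κ * ℓ * Real.log N := by gcongr
  have h8 : logRatio N ≤ ℓ * θ := by
    calc logRatio N ≤ 1.111 * Real.log 4 * (N / Real.log N) := h1
      _ ≤ 1.112 * Real.log 4 * (κ * ℓ) := by
          gcongr
          norm_num
      _ = ℓ * θ := by rw [hκ]; field_simp
  rw [Real.rpow_def_of_pos hT]
  exact Real.exp_le_exp.2 h8

/-- For the same `N`, with `θ = (1 - β) exp (-x)`, the main term of the resonance inequality
exceeds the threshold of the theorem by a positive constant, namely half of the slack of
`slack_pos`. -/
lemma exists_eventually_threshold_add_le {β : ℝ} (hβ1 : β < 1) (x : ℝ) :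
    ∃ c : ℝ, 0 < c ∧ ∀ᶠ T : ℝ in atTop, ∀ N : ℕ,
      N = ⌊(1 - β) * Real.exp (-x) / (1.112 * Real.log 4) * Real.log T *
        Real.log (Real.log T)⌋₊ →
      Real.log (Real.log T) + Real.log (Real.log (Real.log T)) + C₁ β - x + c ≤
        ∑ d ∈ Finset.Ioc 0 N, vonMangoldt d / d * (1 - d / N) := by
  have hl4 : 0 < Real.log 4 := Real.log_pos (by norm_num)
  have hslack := slack_pos
  set c₀ := Real.eulerMascheroniConstant +
    (∑' k : ℕ, ∑' p : Nat.Primes, Real.log (p : ℕ) / ((p : ℕ) : ℝ) ^ (k + 2)) - 1 -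
      Real.log 1.112 with hc₀
  refine ⟨c₀ / 2, by positivity, ?_⟩
  have hβ : 0 < 1 - β := sub_pos.2 hβ1
  set κ := (1 - β) * Real.exp (-x) / (1.112 * Real.log 4) with hκ
  have hκ0 : 0 < κ := by positivity
  have hlogκ : Real.log κ = Real.log (1 - β) - x - Real.log 1.112 - Real.log (Real.log 4) := by
    rw [hκ, Real.log_div (by positivity) (by positivity), Real.log_mul hβ.ne' (Real.exp_ne_zero _),
      Real.log_exp, Real.log_mul (by norm_num) hl4.ne']
    ring
  have hlog := Real.tendsto_log_atTop
  have hlog2 := hlog.comp hlog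
  have hy : Tendsto (fun T : ℝ ↦ κ * Real.log T * Real.log (Real.log T)) atTop atTop :=
    (hlog.const_mul_atTop hκ0).atTop_mul_atTop₀ hlog2
  have hN := (tendsto_nat_floor_atTop (α := ℝ)).comp hy
  have hsmall : ∀ᶠ n : ℕ in atTop, (Real.log n + 1) / n ≤ c₀ / 2 := by
    have h1 : Tendsto (fun y : ℝ ↦ Real.log y / y + 1 / y) atTop (𝓝 0) := by
      have := Real.isLittleO_log_id_atTop.tendsto_div_nhds_zero.add
        (tendsto_inv_atTop_zero (𝕜 := ℝ))
      simpa using this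
    filter_upwards [(h1.comp tendsto_natCast_atTop_atTop).eventually_le_const
      (by positivity : 0 < c₀ / 2)] with n hn
    rw [add_div]
    exact hn
  filter_upwards [hN.eventually hsmall, hN.eventually_ge_atTop 1, hlog.eventually_gt_atTop 1,
    hlog2.eventually_gt_atTop 0] with T h1 h2 h3 h4 N hNT
  simp only [Function.comp_apply] at h1 h2 h4
  rw [← hNT] at h1 h2
  have hlow := le_sum_vonMangoldt_div_mul h2
  set ℓ := Real.log T
  set ℓ₂ := Real.log ℓ
  set y := κ * ℓ * ℓ₂ with hy_def
  have hy0 : 0 < y := by positivity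
  have hyN : y < N + 1 := by rw [hNT]; exact Nat.lt_floor_add_one y
  have hN0 : (0 : ℝ) < N := by exact_mod_cast h2
  have h5 : Real.log y ≤ Real.log N + 1 / N := by
    have h6 := Real.log_le_sub_one_of_pos (x := (N + 1) / N) (by positivity)
    rw [Real.log_div (by positivity) (by positivity)] at h6
    have h7 : ((N : ℝ) + 1) / N - 1 = 1 / N := by field_simp; ring
    have h8 := Real.log_le_log hy0 hyN.le
    linarith
  have h6 : Real.log y = Real.log κ + ℓ₂ + Real.log ℓ₂ := by
    rw [hy_def, Real.log_mul (by positivity) h4.ne', Real.log_mul hκ0.ne' (by positivity)]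
  rw [add_div] at h1
  rw [C₁]
  linarith

/-- The factor `c / (C log ^ 10 (T + 3))` is `T ^ o(1)`; the quotient of logarithms is its exponent. -/
lemma tendsto_log_div_log {C c : ℝ} (hC : 0 < C) (hc : 0 < c) :
    Tendsto (fun T ↦ Real.log (c / (C * Real.log (T + 3) ^ 10)) / Real.log T) atTop (𝓝 0) := by
  have hlog := Real.tendsto_log_atTop
  have h1 : Tendsto (fun T : ℝ ↦ Real.log (Real.log T) / Real.log T) atTop (𝓝 0) :=
    Real.isLittleO_log_id_atTop.tendsto_div_nhds_zero.comp hlog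
  have h2 : Tendsto (fun T : ℝ ↦ (Real.log 2 + Real.log (Real.log T)) / Real.log T) atTop (𝓝 0) := by
    have := (hlog.const_div_atTop (Real.log 2)).add h1
    simpa only [add_zero, add_div] using this
  have h3 : Tendsto (fun T : ℝ ↦ Real.log (Real.log (T + 3)) / Real.log T) atTop (𝓝 0) := by
    refine squeeze_zero' ?_ ?_ h2
    · filter_upwards [eventually_ge_atTop 3] with T hT
      have h4 : 1 ≤ Real.log (T + 3) := by
        rw [Real.le_log_iff_exp_le (by linarith)]
        linarith [Real.exp_one_lt_d9]
      exact div_nonneg (Real.log_nonneg h4) (Real.log_nonneg (by linarith))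
    · filter_upwards [eventually_ge_atTop 3] with T hT
      have h5 : 0 < Real.log T := Real.log_pos (by linarith)
      have h6 : 0 < Real.log (T + 3) := Real.log_pos (by linarith)
      gcongr
      rw [← Real.log_mul (by norm_num) h5.ne']
      refine Real.log_le_log h6 ?_
      have h7 : Real.log (T + 3) ≤ Real.log (T ^ 2) := Real.log_le_log (by linarith) (by nlinarith)
      rwa [Real.log_pow] at h7
  have h4 := (hlog.const_div_atTop (Real.log c - Real.log C)).sub (h3.const_mul 10)
  rw [mul_zero, sub_zero] at h4
  refine h4.congr' ?_
  filter_upwards [eventually_ge_atTop 3] with T hT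
  have h6 : 0 < Real.log (T + 3) := Real.log_pos (by linarith)
  rw [Real.log_div hc.ne' (by positivity), Real.log_mul hC.ne' (by positivity), Real.log_pow]
  push_cast
  ring

lemma eventually_log_pow_mul_rpow_le {β α C c : ℝ} (hβ : 0 < β) (hβα : β < α) (hC : 0 < C)
    (hc : 0 < c) : ∀ᶠ T : ℝ in atTop,
    Real.pi / 2 + C * Real.log (T + 3) ^ 10 * T ^ β ≤ c * T ^ α := by
  have h1 : ∀ᶠ T : ℝ in atTop, ‖Real.log T ^ (10 : ℝ)‖ ≤ 1 * ‖T ^ ((α - β) / 2)‖ :=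
    (isLittleO_log_rpow_rpow_atTop 10 (by linarith : 0 < (α - β) / 2)).def one_pos
  have h2 := (tendsto_rpow_atTop (by linarith : 0 < (α - β) / 2)).eventually_ge_atTop
    ((Real.pi / 2 + C * 2 ^ 10) / c)
  filter_upwards [h1, h2, eventually_ge_atTop 3] with T h3 h4 hT
  have hT0 : 0 < T := by linarith
  have hl : 0 < Real.log T := Real.log_pos (by linarith)
  rw [one_mul, Real.norm_of_nonneg (by positivity), Real.norm_of_nonneg (by positivity)] at h3
  norm_cast at h3
  have h5 : Real.log (T + 3) ≤ 2 * Real.log T := by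
    have h7 : Real.log (T + 3) ≤ Real.log (T ^ 2) := Real.log_le_log (by linarith) (by nlinarith)
    rwa [Real.log_pow] at h7
  have h6 : 0 ≤ Real.log (T + 3) := Real.log_nonneg (by linarith)
  set z := T ^ ((α - β) / 2) with hz
  have hz1 : 1 ≤ z := Real.one_le_rpow (by linarith) (by linarith)
  have hTβ : 1 ≤ T ^ β := Real.one_le_rpow (by linarith) hβ.le
  have e : T ^ α = z * z * T ^ β := by
    rw [hz, ← Real.rpow_add hT0, ← Real.rpow_add hT0]
    ring_nf
  rw [div_le_iff₀ hc] at h4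
  have h7 : C * Real.log (T + 3) ^ 10 * T ^ β ≤ C * 2 ^ 10 * z * T ^ β := by
    calc C * Real.log (T + 3) ^ 10 * T ^ β ≤ C * (2 * Real.log T) ^ 10 * T ^ β := by gcongr
      _ = C * 2 ^ 10 * Real.log T ^ 10 * T ^ β := by ring
      _ ≤ C * 2 ^ 10 * z * T ^ β := by gcongr
  have h8 : Real.pi / 2 ≤ Real.pi / 2 * z * T ^ β := by
    have := Real.pi_pos
    have h9 : 1 ≤ z * T ^ β := one_le_mul_of_one_le_of_one_le hz1 hTβ
    nlinarith
  calc Real.pi / 2 + C * Real.log (T + 3) ^ 10 * T ^ β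
      ≤ (Real.pi / 2 + C * 2 ^ 10) * (z * T ^ β) := by linarith
    _ ≤ z * c * (z * T ^ β) := by gcongr
    _ = c * T ^ α := by rw [e]; ring

end LargeValues


open LargeValues MeasureTheory Filter in
theorem theorem2 (β : ℝ) (hβ0 : 0 < β) (hβ1 : β < 1) (x : ℝ) (hx : 0 < x) :
    ∃ E : ℝ → ℝ, Filter.Tendsto E Filter.atTop (nhds 0) ∧
      ∀ᶠ T : ℝ in Filter.atTop,
        ENNReal.ofReal (T ^ (1 - (1 - β) * Real.exp (-x) + E T)) ≤ largeValueMeasure β T x := by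
  obtain ⟨C, hC, hbound⟩ := exists_abs_regularPart_le
  obtain ⟨c, hc, hthr⟩ := exists_eventually_threshold_add_le hβ1 x
  set θ := (1 - β) * Real.exp (-x) with hθ
  have hβ : 0 < 1 - β := sub_pos.2 hβ1
  have hθ0 : 0 < θ := by positivity
  have hθβ : β < 1 - θ := by
    have h1 : Real.exp (-x) < 1 := by simpa using hx
    have h2 : θ < 1 - β := by rw [hθ]; nlinarith
    linarith
  refine ⟨_, tendsto_log_div_log hC (by positivity : 0 < c / 4), ?_⟩
  have hlog := Real.tendsto_log_atTop
  have hV : Tendsto (fun T ↦ Real.log (Real.log T) + Real.log (Real.log (Real.log T)) +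
      (C₁ β - x)) atTop atTop :=
    tendsto_atTop_add_const_right _ _ ((hlog.comp hlog).atTop_add_atTop (hlog.comp (hlog.comp hlog)))
  filter_upwards [hthr, eventually_exp_logRatio_le hθ0, hV.eventually_ge_atTop 0,
    eventually_log_pow_mul_rpow_le hβ0 hθβ hC (by positivity : 0 < c / 4),
    eventually_ge_atTop 3] with T h1 h2 h3 h4 hT
  have hT0 : 0 < T := by linarith
  have h5 := h1 _ rfl
  set N := ⌊θ / (1.112 * Real.log 4) * Real.log T * Real.log (Real.log T)⌋₊
  set V := Real.log (Real.log T) + Real.log (Real.log (Real.log T)) + C₁ β - x with hVdef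
  set B := C * Real.log (T + 3) ^ 10 with hB
  have hl3 : 0 < Real.log (T + 3) := Real.log_pos (by linarith)
  have hB0 : 0 < B := by positivity
  have hTβ : 0 < T ^ β := Real.rpow_pos_of_pos hT0 β
  have hset : largeValueSet β T x = {t | t ∈ Set.Icc (T ^ β) T ∧ V ≤ regularPart 0 t} := by
    ext t
    refine and_congr_right fun ht ↦ ?_
    rw [neg_re_logDeriv_eq_regularPart (hTβ.trans_le ht.1).ne']
  have h6 := resonance_measure N hT0 hTβ.le (V := V) (B := B) (by linarith)
    (fun t ht ↦ (hbound t ht.1).trans ?_) (by linarith)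
  swap
  · have h7 : 0 ≤ Real.log (t + 3) := Real.log_nonneg (by linarith [ht.1])
    have h8 : t ≤ T := ht.2
    have h9 := ht.1
    rw [hB]
    gcongr
  rw [← hset] at h6
  have hfin : volume (largeValueSet β T x) ≠ ⊤ :=
    ((measure_mono fun t ht ↦ ht.1).trans_lt (measure_Icc_lt_top (a := T ^ β) (b := T))).ne
  rw [largeValueMeasure, ENNReal.ofReal_le_iff_le_toReal hfin]
  change _ ≤ volume.real (largeValueSet β T x)
  set M := volume.real (largeValueSet β T x)
  have hM : 0 ≤ M := measureReal_nonneg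
  have h7 : c * (T / 2) ≤ (Real.pi / 2 + B * (T ^ β + M)) * T ^ θ := by
    calc c * (T / 2) ≤ (_ - V) * (T / 2) := by gcongr; linarith
      _ ≤ _ := h6
      _ ≤ _ := by gcongr
  have hTT : T = T ^ (1 - θ) * T ^ θ := by
    rw [← Real.rpow_add hT0, sub_add_cancel, Real.rpow_one]
  -- Divided by `T ^ θ`, the left side is of order `T ^ (1 - θ)`, which dominates `B * T ^ β`
  -- because `β < 1 - θ`; this is where `0 < x` is used.
  have h8 : c / 2 * T ^ (1 - θ) ≤ Real.pi / 2 + B * (T ^ β + M) := by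
    refine le_of_mul_le_mul_right ?_ (Real.rpow_pos_of_pos hT0 θ)
    calc c / 2 * T ^ (1 - θ) * T ^ θ = c * ((T ^ (1 - θ) * T ^ θ) / 2) := by ring
      _ = c * (T / 2) := by rw [← hTT]
      _ ≤ _ := h7
  have h9 : c / 4 * T ^ (1 - θ) ≤ B * M := by linarith
  have hlT : Real.log T ≠ 0 := (Real.log_pos (by linarith)).ne'
  rw [Real.rpow_add hT0]
  have h10 : T ^ (Real.log (c / 4 / B) / Real.log T) = c / 4 / B := by
    rw [Real.rpow_def_of_pos hT0, mul_div_cancel₀ _ hlT, Real.exp_log (by positivity)]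
  rw [h10, ← mul_div_assoc, div_le_iff₀ hB0]
  linarith
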